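/- Let $G$ be a finite simple cubic (that is, $3$-regular) graph on $n\ge 1$ vertices, not necessarily connected. For integers $n_3,n_2,n_1,n_0$, call $G$ $(n_3,n_2,n_1,n_0)$-decomposable if there is a spanning subgraph $H$ of $G$ (same vertex set, edge set contained in that of $G$) having exactly $n_i$ vertices of degree $i$ for every $i\in\{0,1,2,3\}$. Write $kK_4$ for the disjoint union of $k$ copies of the complete graph $K_4$. Then the following hold for every integer $t \ge 0$: (i) if $n=4t$ and $G$ is isomorphic neither to $K_4$ nor to $3K_4$, then $G$ is $(t,t,t,t)$-decomposable; (ii) if $n=4t$ and $G$ is not isomorphic to $2K_4$, then $G$ is $(t-1,t-1,t+1,t+1)$-decomposable; (iii) if $n=4t+2$ and $G$ is not isomorphic to $K_{3,3}$, then $G$ is $(t,t+1,t,t+1)$-decomposable; (iv) if $n=4t+2$, then $G$ is $(t-1,t,t+1,t+2)$-decomposable. -/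

import Mathlib

/-- `m(H,k)`: the number of vertices of degree `k` in the finite graph `H`. -/
noncomputable def SimpleGraph.degreeMultiplicity {V : Type*} [Fintype V]
    (H : SimpleGraph V) (k : ℕ) : ℕ :=
  letI : DecidableRel H.Adj := Classical.decRel _
  (Finset.univ.filter fun v : V => H.degree v = k).card

/-- A `d`-regular graph `G` is `(n_d, n_{d-1}, …, n_0)`-decomposable if it has a spanning subgraph
`H` (a graph `H ≤ G` on the same vertex set) with exactly `n_i` vertices of degree `i` for every
`i ∈ {0, …, d}`. The tuple is listed from `n_d` down to `n_0`, so `n_i` is its entry number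
`d - i`. Entries are integers, so that `t - 1` is a genuine subtraction. -/
def SimpleGraph.IsDecomposable {V : Type*} [Fintype V] (G : SimpleGraph V) {d : ℕ}
    (c : Fin (d + 1) → ℤ) : Prop :=
  ∃ H : SimpleGraph V, H ≤ G ∧
    ∀ i : Fin (d + 1), (H.degreeMultiplicity (i : ℕ) : ℤ) = c i.rev

/-- `kG`: the disjoint union of `k` copies of `G`. -/
def SimpleGraph.disjointCopies {V : Type*} (k : ℕ) (G : SimpleGraph V) :
    SimpleGraph (Fin k × V) where
  Adj a b := a.1 = b.1 ∧ G.Adj a.2 b.2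
  symm := ⟨fun _ _ h => ⟨h.1.symm, h.2.symm⟩⟩
  loopless := ⟨fun a h => G.loopless.irrefl a.2 h.2⟩

/-! Degrees are recorded cumulatively: `cnt C k` counts the vertices of `C` of degree at least `k`.
Adding an edge between vertices of degrees `i` and `j` raises exactly the counts at `i + 1` and `j +
1` by one, so each target becomes a triple `(a, b, c)` of counts for `k = 1, 2, 3`, reached by
adding and removing edges. Complementing in `G` sends `(a, b, c)` to `(n - c, n - b, n - a)`.

On a connected component, `exists_sparse` grows a subgraph with about `c` vertices of degree 3 and
few of degrees 1 and 2. `attains_of_region` adds edges until the count at 2 equals `b`, with the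
count at 1 at most `a` and the count at 3 at least `c`. `attains_of_balanced` then deletes edges
joining two vertices of degree 3 and adds edges joining two of degree 0, which exist by double
counting; the handshake lemma and connectedness settle a last discrepancy of one. Only components
with 4 vertices, or with 6 vertices and no triangle, escape.

For disconnected graphs the triples of disjoint unions add. Both target triples survive gluing, and
an induction over components (`AdjClosed.good_or`) leaves only `K₄`, `2K₄`, `3K₄` and `K₃,₃`. -/

open Classical in
/-- The degree of `v` in `H`, independent of decidability instances. -/
noncomputable def SimpleGraph.vdeg {V : Type*} [Fintype V] (H : SimpleGraph V) (v : V) : ℕ :=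
  (Finset.univ.filter (H.Adj v)).card

/-- The number of vertices of `C` whose degree in `H` is at least `k`. -/
noncomputable def SimpleGraph.cnt {V : Type*} [Fintype V] (H : SimpleGraph V) (C : Finset V)
    (k : ℕ) : ℕ :=
  (C.filter fun v => k ≤ H.vdeg v).card

/-- `C` is a union of connected components of `G`. -/
def SimpleGraph.AdjClosed {V : Type*} (G : SimpleGraph V) (C : Finset V) : Prop :=
  ∀ u ∈ C, ∀ v, G.Adj u v → v ∈ C

/-- `C` is the vertex set of a connected component of `G`. -/
structure SimpleGraph.AdjConn {V : Type*} (G : SimpleGraph V) (C : Finset V) : Prop where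
  closed : G.AdjClosed C
  nonempty : C.Nonempty
  eq_of_subset : ∀ D ⊆ C, G.AdjClosed D → D.Nonempty → D = C

/-! ### Degree counts, single-edge moves and double counting. -/

namespace SimpleGraph

open Finset

section

variable {V : Type*} {G H : SimpleGraph V} {C : Finset V}

theorem AdjClosed.mono (hC : G.AdjClosed C) (h : H ≤ G) : H.AdjClosed C :=
  fun u hu v huv => hC u hu v (h huv)

/-- Otherwise the vertices of `C` satisfying `P` would form a proper nonempty closed subset.
Minimality of a component is used only in this form. -/
theorem AdjConn.exists_cross (hC : G.AdjConn C) (P : V → Prop) {a b : V} (ha : a ∈ C) (hPa : P a)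
    (hb : b ∈ C) (hPb : ¬ P b) : ∃ u ∈ C, ∃ v ∈ C, G.Adj u v ∧ P u ∧ ¬ P v := by
  classical
  by_contra! hc
  have := hC.eq_of_subset (C.filter P) (filter_subset _ _) ?_ ⟨a, mem_filter.2 ⟨ha, hPa⟩⟩
  · rw [← this] at hb
    exact hPb (mem_filter.1 hb).2
  · intro u hu v huv
    rw [mem_filter] at hu ⊢
    have hv := hC.closed u hu.1 v huv
    exact ⟨hv, hc u hu.1 v hv huv hu.2⟩

end

variable {V : Type*} [Fintype V] {G H : SimpleGraph V} {C : Finset V}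

theorem vdeg_mono (h : H ≤ G) (v : V) : H.vdeg v ≤ G.vdeg v := by
  classical
  unfold vdeg
  apply card_le_card
  intro w
  simp only [mem_filter, mem_univ, true_and]
  exact fun hw => h hw

theorem vdeg_bot (v : V) : (⊥ : SimpleGraph V).vdeg v = 0 := by
  classical
  simp [vdeg]

theorem vdeg_pos {u v : V} (h : H.Adj u v) : 0 < H.vdeg u := by
  classical
  unfold vdeg
  exact card_pos.2 ⟨v, by simpa using h⟩

theorem cnt_anti (H : SimpleGraph V) (C : Finset V) {j k : ℕ} (h : j ≤ k) :
    H.cnt C k ≤ H.cnt C j := by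
  unfold cnt
  apply card_le_card
  intro v
  simp only [mem_filter]
  exact fun hv => ⟨hv.1, h.trans hv.2⟩

theorem cnt_zero (H : SimpleGraph V) (C : Finset V) : H.cnt C 0 = C.card := by
  simp [cnt]

theorem cnt_le_card (H : SimpleGraph V) (C : Finset V) (k : ℕ) : H.cnt C k ≤ C.card :=
  card_filter_le _ _

theorem cnt_bot (C : Finset V) {k : ℕ} (hk : 0 < k) : (⊥ : SimpleGraph V).cnt C k = 0 := by
  simp [cnt, vdeg_bot, hk.ne']

theorem exists_vdeg_eq {k : ℕ} (h : H.cnt C (k + 1) < H.cnt C k) : ∃ v ∈ C, H.vdeg v = k := by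
  by_contra! hc
  refine absurd h (not_lt.2 ?_)
  unfold cnt
  apply card_le_card
  intro v
  simp only [mem_filter]
  rintro ⟨hv, hk⟩
  exact ⟨hv, lt_of_le_of_ne hk (hc v hv).symm⟩

theorem cnt_succ_lt {k : ℕ} {v : V} (hv : v ∈ C) (h : H.vdeg v = k) :
    H.cnt C (k + 1) < H.cnt C k := by
  unfold cnt
  apply card_lt_card
  refine ⟨fun w => ?_, fun hs => ?_⟩
  · simp only [mem_filter]
    exact fun hw => ⟨hw.1, by omega⟩
  · have := hs (mem_filter.2 ⟨hv, h.ge⟩)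
    simp only [mem_filter] at this
    omega

theorem card_vdeg_eq (H : SimpleGraph V) (C : Finset V) (k : ℕ) :
    (C.filter fun v => H.vdeg v = k).card + H.cnt C (k + 1) = H.cnt C k := by
  classical
  unfold cnt
  rw [← card_union_of_disjoint]
  · congr 1
    ext v
    simp only [mem_union, mem_filter]
    constructor
    · rintro (⟨h, h'⟩ | ⟨h, h'⟩) <;> exact ⟨h, by omega⟩
    · rintro ⟨h, h'⟩
      rcases h'.eq_or_lt with h'' | h''
      · exact Or.inl ⟨h, h''.symm⟩
      · exact Or.inr ⟨h, h''⟩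
  · rw [Finset.disjoint_left]
    intro v
    simp only [mem_filter]
    rintro ⟨_, h⟩ ⟨_, h'⟩
    omega

/-- Adding an edge of `G` to `H`. -/
theorem exists_add {u v : V} (hC : G.AdjClosed C) (hH : H ≤ G) (hu : u ∈ C) (huv : G.Adj u v)
    (h : ¬ H.Adj u v) {i j : ℕ} (hi : H.vdeg u = i) (hj : H.vdeg v = j) :
    ∃ H' : SimpleGraph V, H' ≤ G ∧ H < H' ∧
      (∀ a b, H'.Adj a b ↔ H.Adj a b ∨ (a = u ∧ b = v) ∨ (a = v ∧ b = u)) ∧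
      H'.vdeg u = i + 1 ∧ H'.vdeg v = j + 1 ∧ (∀ w, w ≠ u → w ≠ v → H'.vdeg w = H.vdeg w) ∧
      ∀ k, H'.cnt C k = H.cnt C k + (if k = i + 1 then 1 else 0) + (if k = j + 1 then 1 else 0) := by
  classical
  have hne : u ≠ v := huv.ne
  have hv : v ∈ C := hC u hu v huv
  have hadj : ∀ a b, (H ⊔ edge u v).Adj a b ↔ H.Adj a b ∨ (a = u ∧ b = v) ∨ (a = v ∧ b = u) := by
    intro a b
    rw [sup_adj, edge_adj]
    constructor
    · tauto
    · rintro (h1 | ⟨rfl, rfl⟩ | ⟨rfl, rfl⟩)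
      · exact Or.inl h1
      · exact Or.inr ⟨Or.inl ⟨rfl, rfl⟩, hne⟩
      · exact Or.inr ⟨Or.inr ⟨rfl, rfl⟩, hne.symm⟩
  have hdu : (H ⊔ edge u v).vdeg u = i + 1 := by
    unfold vdeg at hi ⊢
    rw [← hi, ← card_insert_of_notMem (a := v) (by simpa using h)]
    congr 1
    ext w
    simp only [mem_filter, mem_univ, true_and, mem_insert, hadj]
    tauto
  have hdv : (H ⊔ edge u v).vdeg v = j + 1 := by
    unfold vdeg at hj ⊢
    rw [← hj, ← card_insert_of_notMem (a := u) (by simpa using fun h' => h h'.symm)]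
    congr 1
    ext w
    simp only [mem_filter, mem_univ, true_and, mem_insert, hadj]
    tauto
  have hdw : ∀ w, w ≠ u → w ≠ v → (H ⊔ edge u v).vdeg w = H.vdeg w := by
    intro w h1 h2
    unfold vdeg
    congr 1
    ext x
    simp only [mem_filter, mem_univ, true_and, hadj]
    tauto
  refine ⟨H ⊔ edge u v, ?_, ?_, hadj, hdu, hdv, hdw, ?_⟩
  · refine sup_le hH ?_
    rw [edge_le_iff]
    exact Or.inr huv
  · refine lt_of_le_of_ne le_sup_left ?_
    intro he
    apply h
    rw [he, hadj]
    simp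
  · intro k
    unfold cnt
    simp only [card_filter]
    have e1 : (if k = i + 1 then 1 else 0) = ∑ w ∈ C, if w = u then (if k = i + 1 then 1 else 0) else 0 := by
      rw [sum_ite_eq', if_pos hu]
    have e2 : (if k = j + 1 then 1 else 0) = ∑ w ∈ C, if w = v then (if k = j + 1 then 1 else 0) else 0 := by
      rw [sum_ite_eq', if_pos hv]
    rw [e1, e2, ← sum_add_distrib, ← sum_add_distrib]
    apply sum_congr rfl
    intro w _
    by_cases h1 : w = u
    · subst h1
      rw [hdu, hi]
      simp only [if_pos, if_neg hne]
      split_ifs <;> omega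
    · by_cases h2 : w = v
      · subst h2
        rw [hdv, hj]
        simp only [if_pos, if_neg h1]
        split_ifs <;> omega
      · rw [hdw w h1 h2]
        simp [h1, h2]

/-- Removing an edge of `H`. -/
theorem exists_remove {u v : V} (hC : G.AdjClosed C) (hH : H ≤ G) (hu : u ∈ C) (h : H.Adj u v)
    {i j : ℕ} (hi : H.vdeg u = i + 1) (hj : H.vdeg v = j + 1) :
    ∃ H' : SimpleGraph V, H' ≤ G ∧
      (∀ a b, H.Adj a b ↔ H'.Adj a b ∨ (a = u ∧ b = v) ∨ (a = v ∧ b = u)) ∧ ¬ H'.Adj u v ∧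
      H'.vdeg u = i ∧ H'.vdeg v = j ∧ (∀ w, w ≠ u → w ≠ v → H'.vdeg w = H.vdeg w) ∧
      ∀ k, H.cnt C k = H'.cnt C k + (if k = i + 1 then 1 else 0) + (if k = j + 1 then 1 else 0) := by
  have hle : H.deleteEdges {s(u, v)} ≤ H := deleteEdges_le _
  have hn : ¬ (H.deleteEdges {s(u, v)}).Adj u v := by simp [deleteEdges_adj]
  obtain ⟨H', -, -, hadj, hdu, hdv, hdw, hc⟩ :=
    exists_add hC (hle.trans hH) hu (hH h) hn rfl rfl
  have he : H' = H := by
    ext a b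
    rw [hadj, deleteEdges_adj]
    simp only [Set.mem_singleton_iff, Sym2.eq_iff]
    constructor
    · rintro (h1 | ⟨rfl, rfl⟩ | ⟨rfl, rfl⟩)
      · exact h1.1
      · exact h
      · exact h.symm
    · tauto
  subst he
  have h1 : (H'.deleteEdges {s(u, v)}).vdeg u = i := by omega
  have h2 : (H'.deleteEdges {s(u, v)}).vdeg v = j := by omega
  rw [h1, h2] at hc
  exact ⟨_, hle.trans hH, hadj, hn, h1, h2, fun w h3 h4 => (hdw w h3 h4).symm, hc⟩

theorem exists_adj_of_vdeg_pos {u : V} (h : 0 < H.vdeg u) : ∃ v, H.Adj u v := by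
  classical
  obtain ⟨v, hv⟩ := card_pos.1 h
  exact ⟨v, by simpa using hv⟩

theorem exists_out {u : V} (h : H.vdeg u < G.vdeg u) :
    ∃ v, G.Adj u v ∧ ¬ H.Adj u v := by
  classical
  by_contra! hc
  refine absurd h (not_lt.2 ?_)
  unfold vdeg
  apply card_le_card
  intro w
  simpa using hc w

theorem exists_out_ne {u : V} (h : H.vdeg u + 1 < G.vdeg u) (x : V) :
    ∃ v, v ≠ x ∧ G.Adj u v ∧ ¬ H.Adj u v := by
  classical
  by_contra! hc
  refine absurd h (not_lt.2 ?_)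
  unfold vdeg
  refine le_trans (card_le_card (t := insert x (Finset.univ.filter (H.Adj u))) ?_) (card_insert_le _ _)
  intro w
  simp only [mem_filter, mem_univ, true_and, mem_insert]
  intro hw
  by_cases hx : w = x
  · exact Or.inl hx
  · exact Or.inr (hc w hx hw)

theorem adj_of_vdeg_eq (hH : H ≤ G) {u v : V} (h : H.vdeg u = G.vdeg u) (huv : G.Adj u v) :
    H.Adj u v := by
  classical
  have hs : Finset.univ.filter (H.Adj u) ⊆ Finset.univ.filter (G.Adj u) := by
    intro w
    simp only [mem_filter, mem_univ, true_and]
    exact fun hw => hH hw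
  have he := eq_of_subset_of_card_le hs h.ge
  have : v ∈ Finset.univ.filter (G.Adj u) := by simpa using huv
  rw [← he] at this
  simpa using this

theorem sum_vdeg (H : SimpleGraph V) (C : Finset V) (h3 : ∀ v, H.vdeg v ≤ 3) :
    ∑ v ∈ C, H.vdeg v = H.cnt C 1 + H.cnt C 2 + H.cnt C 3 := by
  unfold cnt
  simp only [card_filter]
  rw [← sum_add_distrib, ← sum_add_distrib]
  apply sum_congr rfl
  intro v _
  have := h3 v
  split_ifs <;> omega

/-- The handshake lemma for `H` restricted to `C`; closedness makes the one-sided condition `a ∈ C`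
symmetric. -/
theorem even_sum_vdeg (hC : H.AdjClosed C) : Even (∑ v ∈ C, H.vdeg v) := by
  classical
  let K : SimpleGraph V :=
    { Adj := fun a b => a ∈ C ∧ H.Adj a b
      symm := ⟨fun a b h => ⟨hC a h.1 b h.2, h.2.symm⟩⟩
      loopless := ⟨fun a h => H.loopless.irrefl a h.2⟩ }
  have h1 := K.sum_degrees_eq_twice_card_edges
  have h2 : ∑ v, K.degree v = ∑ v ∈ C, H.vdeg v := by
    rw [← sum_subset (subset_univ C)]
    · apply sum_congr rfl
      intro v hv
      unfold vdeg
      rw [← card_neighborFinset_eq_degree]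
      congr 1
      ext w
      simp [K, hv]
    · intro v _ hv
      rw [← card_neighborFinset_eq_degree, card_eq_zero]
      ext w
      simp [K, hv]
  rw [← h2, h1]
  exact even_two_mul _

theorem even_cnt (hC : G.AdjClosed C) (hG : ∀ v, G.vdeg v = 3) (hH : H ≤ G) :
    Even (H.cnt C 1 + H.cnt C 2 + H.cnt C 3) := by
  rw [← sum_vdeg H C fun v => (vdeg_mono hH v).trans (hG v).le]
  exact even_sum_vdeg (hC.mono hH)

/-- Double counting: the vertices of degree at least `3` span an edge when there are many. -/
theorem exists_adj_three_three (hC : G.AdjClosed C) (hG : ∀ v, G.vdeg v = 3) (hH : H ≤ G)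
    (h : H.cnt C 1 + H.cnt C 2 < 5 * H.cnt C 3) :
    ∃ u ∈ C, ∃ v ∈ C, H.Adj u v ∧ H.vdeg u = 3 ∧ H.vdeg v = 3 := by
  classical
  by_contra! hc
  have hle : ∀ v, H.vdeg v ≤ 3 := fun v => (vdeg_mono hH v).trans (hG v).le
  set A := C.filter fun v => 3 ≤ H.vdeg v with hA
  set B := C.filter fun v => ¬ 3 ≤ H.vdeg v with hB
  have h1 : ∑ v ∈ A, H.vdeg v + ∑ v ∈ B, H.vdeg v = ∑ v ∈ C, H.vdeg v :=
    sum_filter_add_sum_filter_not _ _ _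
  have h2 : ∑ v ∈ A, H.vdeg v = 3 * H.cnt C 3 := by
    rw [sum_const_nat (m := 3), mul_comm]
    · rfl
    · intro v hv
      have := (mem_filter.1 hv).2
      have := hle v
      omega
  -- If no edge lies inside `A`, all edges at `A` end in `B`. Since the total degree is the sum of
  -- the three counts, this reads `6 * cnt 3 ≤ cnt 1 + cnt 2 + cnt 3`, whence the constant 5.
  have h3 : ∑ v ∈ A, H.vdeg v ≤ ∑ v ∈ B, H.vdeg v := by
    have e1 : ∀ v ∈ A, H.vdeg v = (bipartiteAbove H.Adj B v).card := by
      intro v hv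
      unfold vdeg bipartiteAbove
      congr 1
      ext w
      simp only [mem_filter, mem_univ, true_and]
      refine ⟨fun hw => ⟨?_, hw⟩, fun hw => hw.2⟩
      have hvC := (mem_filter.1 hv).1
      have hv3 := (mem_filter.1 hv).2
      have hwC := hC v hvC w (hH hw)
      refine mem_filter.2 ⟨hwC, fun hw3 => ?_⟩
      exact hc v hvC w hwC hw (le_antisymm (hle v) hv3) (le_antisymm (hle w) hw3)
    rw [sum_congr rfl e1, sum_card_bipartiteAbove_eq_sum_card_bipartiteBelow]
    apply sum_le_sum
    intro w _
    unfold vdeg bipartiteBelow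
    apply card_le_card
    intro v
    simp only [mem_filter, mem_univ, true_and]
    exact fun hv => hv.2.symm
  have h4 := sum_vdeg H C hle
  omega

theorem vdeg_sdiff (hH : H ≤ G) (v : V) : (G \ H).vdeg v + H.vdeg v = G.vdeg v := by
  classical
  unfold vdeg
  rw [← card_union_of_disjoint]
  · congr 1
    ext w
    simp only [mem_union, mem_filter, mem_univ, true_and, sdiff_adj]
    constructor
    · rintro (h | h)
      · exact h.1
      · exact hH h
    · tauto
  · rw [Finset.disjoint_left]
    intro w
    simp only [mem_filter, mem_univ, true_and, sdiff_adj]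
    tauto

theorem cnt_sdiff (hG : ∀ v, G.vdeg v = 3) (hH : H ≤ G) (C : Finset V) {j k : ℕ}
    (hjk : j + k = 4) : (G \ H).cnt C j + H.cnt C k = C.card := by
  classical
  unfold cnt
  have := C.card_filter_add_card_filter_not (fun v => j ≤ (G \ H).vdeg v)
  rw [← this]
  congr 2
  ext v
  simp only [mem_filter]
  have := vdeg_sdiff hH v
  have := hG v
  constructor <;> rintro ⟨h1, h2⟩ <;> exact ⟨h1, by omega⟩

/-- Degree 0 in `H` is degree 3 in `G \ H`, so this is `exists_adj_three_three` for the complement.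
-/
theorem exists_adj_zero_zero (hC : G.AdjClosed C) (hG : ∀ v, G.vdeg v = 3) (hH : H ≤ G)
    (h : 5 * H.cnt C 1 < 3 * C.card + H.cnt C 2 + H.cnt C 3) :
    ∃ u ∈ C, ∃ v ∈ C, G.Adj u v ∧ H.vdeg u = 0 ∧ H.vdeg v = 0 := by
  have h1 := cnt_sdiff hG hH C (j := 1) (k := 3) rfl
  have h2 := cnt_sdiff hG hH C (j := 2) (k := 2) rfl
  have h3 := cnt_sdiff hG hH C (j := 3) (k := 1) rfl
  obtain ⟨u, hu, v, hv, huv, hdu, hdv⟩ :=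
    exists_adj_three_three (H := G \ H) hC hG sdiff_le (by omega)
  have h4 := vdeg_sdiff hH u
  have h5 := vdeg_sdiff hH v
  have := hG u
  have := hG v
  exact ⟨u, hu, v, hv, ((sdiff_adj _ _ _ _).1 huv).1, by omega, by omega⟩

end SimpleGraph

/-! ### Steering a subgraph of a connected component to prescribed counts. -/

namespace SimpleGraph

variable {V : Type*} [Fintype V] {G H : SimpleGraph V} {C : Finset V}

/-- Some subgraph of `G` has `a`, `b`, `c` vertices of `C` of degree at least `1`, `2`, `3`. -/
def Attains (G : SimpleGraph V) (C : Finset V) (a b c : ℕ) : Prop :=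
  ∃ H ≤ G, H.cnt C 1 = a ∧ H.cnt C 2 = b ∧ H.cnt C 3 = c

theorem exists_maximal_graph {P : SimpleGraph V → Prop} (h : ∃ H, P H) :
    ∃ H, P H ∧ ∀ K, P K → ¬ H < K := by
  obtain ⟨M, hM⟩ := (Set.toFinite {H | P H}).exists_maximal h
  exact ⟨M, hM.prop, fun K hK hlt => hM.not_gt hK hlt⟩

theorem vdeg_le_three (hG : ∀ v, G.vdeg v = 3) (hH : H ≤ G) (v : V) : H.vdeg v ≤ 3 :=
  (vdeg_mono hH v).trans (hG v).le

theorem adj_of_vdeg_eq_three (hG : ∀ v, G.vdeg v = 3) (hH : H ≤ G) {u v : V}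
    (h : H.vdeg u = 3) (huv : G.Adj u v) : H.Adj u v :=
  adj_of_vdeg_eq hH (h.trans (hG u).symm) huv

/-- A subgraph with the right number of vertices of degree at least `2`, enough vertices of
degree `3` and enough vertices of degree `0` can be adjusted to have exactly the wanted degrees. -/
theorem AdjConn.attains_of_balanced (hC : G.AdjConn C) (hG : ∀ v, G.vdeg v = 3) {a b c : ℕ}
    (hpar : Even (a + b + c)) (h33 : a + b ≤ 5 * c + 4) (h00 : 5 * a ≤ 3 * C.card + b + c)
    (ha : a ≤ C.card) (hH : H ≤ G) (h1 : H.cnt C 1 ≤ a) (h2 : H.cnt C 2 = b)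
    (h3 : c ≤ H.cnt C 3) : G.Attains C a b c := by
  induction hm : (a - H.cnt C 1) + (H.cnt C 3 - c) using Nat.strong_induction_on
    generalizing H with
  | _ m ih =>
  -- Deleting a 3–3 edge lowers only the count at 3, by two; adding a 0–0 edge raises only the count
  -- at 1, by two.
  by_cases hr : c + 2 ≤ H.cnt C 3
  · obtain ⟨u, hu, v, hv, huv, hdu, hdv⟩ :=
      exists_adj_three_three hC.closed hG hH (by omega)
    obtain ⟨K, hK, -, -, -, -, -, hc⟩ := exists_remove (i := 2) (j := 2) hC.closed hH hu huv hdu hdv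
    have c1 := hc 1
    have c2 := hc 2
    have c3 := hc 3
    norm_num at c1 c2 c3
    exact ih _ (by omega) hK (by omega) (by omega) (by omega) rfl
  by_cases hp : H.cnt C 1 + 2 ≤ a
  · obtain ⟨u, hu, v, hv, huv, hdu, hdv⟩ :=
      exists_adj_zero_zero hC.closed hG hH (by omega)
    have hn : ¬ H.Adj u v := fun h => by have := vdeg_pos h; omega
    obtain ⟨K, hK, -, -, -, -, -, hc⟩ := exists_add hC.closed hH hu huv hn hdu hdv
    have c1 := hc 1
    have c2 := hc 2
    have c3 := hc 3
    norm_num at c1 c2 c3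
    exact ih _ (by omega) hK (by omega) (by omega) (by omega) rfl
  -- Both deviations are now at most one, and by parity they are equal.
  have hpar' := even_cnt hC.closed hG hH
  rw [Nat.even_iff] at hpar hpar'
  by_cases hz : H.cnt C 1 = a
  · exact ⟨H, hH, hz, h2, by omega⟩
  have hz1 : H.cnt C 1 + 1 = a := by omega
  have hz3 : H.cnt C 3 = c + 1 := by omega
  -- Deleting a 1–3 edge repairs the count at 3 and leaves the count at 1 two short, which a 0–0
  -- edge supplies. The next case is the mirror image under complementation.
  by_cases h13 : ∃ u ∈ C, ∃ v, H.Adj u v ∧ H.vdeg u = 1 ∧ H.vdeg v = 3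
  · obtain ⟨u, hu, v, huv, hdu, hdv⟩ := h13
    obtain ⟨K, hK, -, -, -, -, -, hc⟩ := exists_remove (i := 0) (j := 2) hC.closed hH hu huv hdu hdv
    have c1 := hc 1
    have c2 := hc 2
    have c3 := hc 3
    norm_num at c1 c2 c3
    obtain ⟨x, hx, y, hy, hxy, hdx, hdy⟩ :=
      exists_adj_zero_zero hC.closed hG hK (by omega)
    have hn : ¬ K.Adj x y := fun h => by have := vdeg_pos h; omega
    obtain ⟨L, hL, -, -, -, -, -, hc'⟩ := exists_add hC.closed hK hx hxy hn hdx hdy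
    have c1' := hc' 1
    have c2' := hc' 2
    have c3' := hc' 3
    norm_num at c1' c2' c3'
    exact ⟨L, hL, by omega, by omega, by omega⟩
  by_cases h02 : ∃ u ∈ C, ∃ v, G.Adj u v ∧ ¬ H.Adj u v ∧ H.vdeg u = 0 ∧ H.vdeg v = 2
  · obtain ⟨u, hu, v, huv, hn, hdu, hdv⟩ := h02
    obtain ⟨K, hK, -, -, -, -, -, hc⟩ := exists_add hC.closed hH hu huv hn hdu hdv
    have c1 := hc 1
    have c2 := hc 2
    have c3 := hc 3
    norm_num at c1 c2 c3
    obtain ⟨x, hx, y, hy, hxy, hdx, hdy⟩ :=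
      exists_adj_three_three hC.closed hG hK (by omega)
    obtain ⟨L, hL, -, -, -, -, -, hc'⟩ := exists_remove (i := 2) (j := 2) hC.closed hK hx hxy hdx hdy
    have c1' := hc' 1
    have c2' := hc' 2
    have c3' := hc' 3
    norm_num at c1' c2' c3'
    exact ⟨L, hL, by omega, by omega, by omega⟩
  have hle := vdeg_le_three hG hH
  obtain ⟨z, hz, hdz⟩ := exists_vdeg_eq (H := H) (C := C) (k := 0) (by rw [cnt_zero, zero_add]; omega)
  obtain ⟨s, hs, hds⟩ := exists_vdeg_eq (H := H) (C := C) (k := 3) (by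
    by_contra hcon
    have : H.cnt C (3 + 1) = 0 := by
      simp only [cnt, Finset.card_eq_zero, Finset.filter_eq_empty_iff]
      intro v _
      have := hle v
      omega
    omega)
  -- With those moves unavailable, an edge leaving the degree-3 set ends at degree 2, and one
  -- leaving the degree-0 set ends at degree 1. Adding the latter and deleting the former corrects
  -- the counts at 1 and 3, while the changes at 2 cancel.
  obtain ⟨x, hx, y, hy, hxy, hdx, hdy⟩ :=
    hC.exists_cross (fun v => H.vdeg v = 3) hs hds hz (by omega)
  obtain ⟨w, hw, p, hp', hwp, hdw, hdp⟩ :=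
    hC.exists_cross (fun v => H.vdeg v = 0) hz hdz hs (by omega)
  have hxy' := adj_of_vdeg_eq_three hG hH hdx hxy
  have hdy2 : H.vdeg y = 2 := by
    have := hle y
    have := vdeg_pos hxy'.symm
    have : H.vdeg y ≠ 1 := fun h => h13 ⟨y, hy, x, hxy'.symm, h, hdx⟩
    omega
  have hnwp : ¬ H.Adj w p := fun h => by have := vdeg_pos h; omega
  have hdp1 : H.vdeg p = 1 := by
    have := hle p
    have : H.vdeg p ≠ 2 := fun h => h02 ⟨w, hw, p, hwp, hnwp, hdw, h⟩
    have : H.vdeg p ≠ 3 := fun h => hnwp (adj_of_vdeg_eq_three hG hH h hwp.symm).symm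
    omega
  obtain ⟨K, hK, -, hadj, -, -, hdeg, hc⟩ := exists_add hC.closed hH hw hwp hnwp hdw hdp1
  have c1 := hc 1
  have c2 := hc 2
  have c3 := hc 3
  norm_num at c1 c2 c3
  have hKx : K.vdeg x = 2 + 1 := by
    rw [hdeg x (by rintro rfl; omega) (by rintro rfl; omega)]; exact hdx
  have hKy : K.vdeg y = 1 + 1 := by
    rw [hdeg y (by rintro rfl; omega) (by rintro rfl; omega)]; exact hdy2
  obtain ⟨L, hL, -, -, -, -, -, hc'⟩ :=
    exists_remove hC.closed hK hx ((hadj x y).2 (Or.inl hxy')) hKx hKy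
  have c1' := hc' 1
  have c2' := hc' 2
  have c3' := hc' 3
  norm_num at c1' c2' c3'
  exact ⟨L, hL, by omega, by omega, by omega⟩

/-- The region of subgraphs from which edges can be added until they are balanced. -/
theorem AdjConn.attains_of_region (hC : G.AdjConn C) (hG : ∀ v, G.vdeg v = 3) {a b c : ℕ}
    (hpar : Even (a + b + c)) (h33 : a + b ≤ 5 * c + 4) (h00 : 5 * a ≤ 3 * C.card + b + c)
    (ha : a < C.card) (hba : b < a) (hc : 0 < c)
    (hex : ∃ H ≤ G, c ≤ H.cnt C 3 ∧ H.cnt C 1 + b ≤ H.cnt C 2 + a ∧ H.cnt C 2 ≤ b) :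
    G.Attains C a b c := by
  -- The region caps the number of degree-1 vertices, `cnt 1 - cnt 2`, by `a - b`. While `cnt 2 <
  -- b`, adding a 2–2, 1–2 or 0–1 edge stays inside it, so maximality forbids such edges outside
  -- `H`.
  obtain ⟨H, ⟨hH, h3, h1, h2⟩, hmax⟩ := exists_maximal_graph hex
  by_cases hq0 : H.cnt C 2 = b
  · exact hC.attains_of_balanced hG hpar h33 h00 ha.le hH (by omega) hq0 h3
  have hle := vdeg_le_three hG hH
  have h22 : ∀ u ∈ C, ∀ v, G.Adj u v → ¬ H.Adj u v → H.vdeg u = 2 → H.vdeg v ≠ 2 := by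
    intro u hu v huv hn hdu hdv
    obtain ⟨K, hK, hlt, -, -, -, -, hk⟩ := exists_add hC.closed hH hu huv hn hdu hdv
    have c1 := hk 1
    have c2 := hk 2
    have c3 := hk 3
    norm_num at c1 c2 c3
    exact hmax K ⟨hK, by omega, by omega, by omega⟩ hlt
  have h12 : ∀ u ∈ C, ∀ v, G.Adj u v → ¬ H.Adj u v → H.vdeg u = 1 → H.vdeg v ≠ 2 := by
    intro u hu v huv hn hdu hdv
    obtain ⟨K, hK, hlt, -, -, -, -, hk⟩ := exists_add hC.closed hH hu huv hn hdu hdv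
    have c1 := hk 1
    have c2 := hk 2
    have c3 := hk 3
    norm_num at c1 c2 c3
    exact hmax K ⟨hK, by omega, by omega, by omega⟩ hlt
  have h01 : ∀ u ∈ C, ∀ v, G.Adj u v → ¬ H.Adj u v → H.vdeg u = 1 → H.vdeg v ≠ 0 := by
    intro u hu v huv hn hdu hdv
    obtain ⟨K, hK, hlt, -, -, -, -, hk⟩ := exists_add hC.closed hH hu huv hn hdu hdv
    have c1 := hk 1
    have c2 := hk 2
    have c3 := hk 3
    norm_num at c1 c2 c3
    exact hmax K ⟨hK, by omega, by omega, by omega⟩ hlt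
  have hout : ∀ u ∈ C, ∀ v, G.Adj u v → ¬ H.Adj u v → H.vdeg u = 1 → H.vdeg v = 1 := by
    intro u hu v huv hn hdu
    have := hle v
    have := h12 u hu v huv hn hdu
    have := h01 u hu v huv hn hdu
    have : H.vdeg v ≠ 3 := fun h => hn (adj_of_vdeg_eq_three hG hH h huv.symm).symm
    omega
  obtain ⟨z, hz, hdz⟩ := exists_vdeg_eq (H := H) (C := C) (k := 0) (by rw [cnt_zero, zero_add]; omega)
  obtain ⟨s, hs, hds⟩ : ∃ s ∈ C, H.vdeg s = 3 := by
    obtain ⟨s, hs⟩ := Finset.card_pos.1 (show 0 < H.cnt C 3 by omega)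
    rw [Finset.mem_filter] at hs
    exact ⟨s, hs.1, le_antisymm (hle s) hs.2⟩
  -- With slack in the cap, a 0–2 edge leaving the degree-0 set could still be added, or a 0–0 edge
  -- is met first and excluded by the choice of the crossing edge.
  by_cases hcap : H.cnt C 1 + b + 1 ≤ H.cnt C 2 + a
  · exfalso
    obtain ⟨w, hw, p, hp', hwp, hdw, hdp⟩ :=
      hC.exists_cross (fun v => H.vdeg v = 0) hz hdz hs (by omega)
    have hnwp : ¬ H.Adj w p := fun h => by have := vdeg_pos h; omega
    have : H.vdeg p ≠ 3 := fun h => hnwp (adj_of_vdeg_eq_three hG hH h hwp.symm).symm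
    have : H.vdeg p ≠ 1 := fun h => h01 p hp' w hwp.symm (fun h' => hnwp h'.symm) h hdw
    have hdp2 : H.vdeg p = 2 := by have := hle p; omega
    obtain ⟨K, hK, hlt, -, -, -, -, hk⟩ := exists_add hC.closed hH hw hwp hnwp hdw hdp2
    have c1 := hk 1
    have c2 := hk 2
    have c3 := hk 3
    norm_num at c1 c2 c3
    exact hmax K ⟨hK, by omega, by omega, by omega⟩ hlt
  obtain ⟨x, hx, hdx⟩ := exists_vdeg_eq (H := H) (C := C) (k := 1) (by norm_num; omega)
  -- Adding a 1–1 edge raises the count at 2 by two, so it is blocked only one step below `b`.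
  have hq1 : H.cnt C 2 + 1 = b := by
    by_contra hq
    obtain ⟨y, hxy, hn⟩ := exists_out (G := G) (H := H) (u := x) (by rw [hG]; omega)
    have hdy := hout x hx y hxy hn hdx
    obtain ⟨K, hK, hlt, -, -, -, -, hk⟩ := exists_add hC.closed hH hx hxy hn hdx hdy
    have c1 := hk 1
    have c2 := hk 2
    have c3 := hk 3
    norm_num at c1 c2 c3
    exact hmax K ⟨hK, by omega, by omega, by omega⟩ hlt
  -- Here the counts at 1 and 2 are `a - 1` and `b - 1`. Adding a path 0–0–2 and deleting the 1–3
  -- edge raises both by one and keeps the count at 3.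
  by_cases h13 : ∃ u ∈ C, ∃ v, H.Adj u v ∧ H.vdeg u = 1 ∧ H.vdeg v = 3
  · obtain ⟨u, hu, v, huv, hdu, hdv⟩ := h13
    obtain ⟨z1, hz1, z2, hz2, hz12, hdz1, hdz2⟩ :=
      exists_adj_zero_zero hC.closed hG hH (by omega)
    obtain ⟨w, hw, p, hp, hwp, ⟨hdw, w', hww', hdw'⟩, hnp⟩ :=
      hC.exists_cross (fun v => H.vdeg v = 0 ∧ ∃ v', G.Adj v v' ∧ H.vdeg v' = 0) hz1
        ⟨hdz1, z2, hz12, hdz2⟩ hs (by omega)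
    have hnwp : ¬ H.Adj w p := fun h => by have := vdeg_pos h; omega
    have hnww : ¬ H.Adj w w' := fun h => by have := vdeg_pos h; omega
    have : H.vdeg p ≠ 3 := fun h => hnwp (adj_of_vdeg_eq_three hG hH h hwp.symm).symm
    have : H.vdeg p ≠ 1 := fun h => h01 p hp w hwp.symm (fun h' => hnwp h'.symm) h hdw
    have : H.vdeg p ≠ 0 := fun h => hnp ⟨h, w, hwp.symm, hdw⟩
    have hdp2 : H.vdeg p = 2 := by have := hle p; omega
    obtain ⟨K, hK, -, hadj, hKw, -, hdeg, hk⟩ := exists_add hC.closed hH hw hww' hnww hdw hdw'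
    have c1 := hk 1
    have c2 := hk 2
    have c3 := hk 3
    norm_num at c1 c2 c3
    have hpw' : p ≠ w' := by rintro rfl; omega
    have hKp : K.vdeg p = 2 := by rw [hdeg p hwp.ne' hpw']; exact hdp2
    have hnK : ¬ K.Adj w p := by
      rw [hadj]
      rintro (h | ⟨-, h⟩ | ⟨h, -⟩)
      · exact hnwp h
      · exact hpw' h
      · exact hww'.ne h
    obtain ⟨L, hL, -, hadjL, -, -, hdegL, hk'⟩ := exists_add hC.closed hK hw hwp hnK hKw hKp
    have c1' := hk' 1
    have c2' := hk' 2
    have c3' := hk' 3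
    norm_num at c1' c2' c3'
    have hLu : L.vdeg u = 0 + 1 := by
      rw [hdegL u (by rintro rfl; omega) (by rintro rfl; omega),
        hdeg u (by rintro rfl; omega) (by rintro rfl; omega)]
      exact hdu
    have hLv : L.vdeg v = 2 + 1 := by
      rw [hdegL v (by rintro rfl; omega) (by rintro rfl; omega),
        hdeg v (by rintro rfl; omega) (by rintro rfl; omega)]
      exact hdv
    have hLuv : L.Adj u v := (hadjL u v).2 (Or.inl ((hadj u v).2 (Or.inl huv)))
    obtain ⟨M, hM, -, -, -, -, -, hk''⟩ := exists_remove hC.closed hL hu hLuv hLu hLv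
    have c1'' := hk'' 1
    have c2'' := hk'' 2
    have c3'' := hk'' 3
    norm_num at c1'' c2'' c3''
    exact hC.attains_of_balanced hG hpar h33 h00 ha.le hM (by omega) (by omega) (by omega)
  -- Replacing the edge `uy` by the path `u v r` through degree-1 vertices raises the counts at 2
  -- and 3 by one and keeps the count at 1.
  by_cases h12' : ∃ u ∈ C, ∃ v, H.Adj u v ∧ H.vdeg u = 1 ∧ H.vdeg v = 2
  · obtain ⟨u, hu, y, huy, hdu, hdy⟩ := h12'
    obtain ⟨v, huv, hn⟩ := exists_out (G := G) (H := H) (u := u) (by rw [hG]; omega)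
    have hv := hC.closed u hu v huv
    have hdv := hout u hu v huv hn hdu
    obtain ⟨r, hru, hvr, hnr⟩ := exists_out_ne (G := G) (H := H) (u := v) (by rw [hG]; omega) u
    have hdr := hout v hv r hvr hnr hdv
    obtain ⟨K, hK, hadj, -, hKu, hKy, hdeg, hk⟩ :=
      exists_remove (i := 0) (j := 1) hC.closed hH hu huy hdu hdy
    have c1 := hk 1
    have c2 := hk 2
    have c3 := hk 3
    norm_num at c1 c2 c3
    have hvy : v ≠ y := by rintro rfl; omega
    have hry : r ≠ y := by rintro rfl; omega
    have hKv : K.vdeg v = 1 := by rw [hdeg v huv.ne' hvy]; exact hdv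
    have hKr : K.vdeg r = 1 := by rw [hdeg r hru hry]; exact hdr
    have hnK : ¬ K.Adj u v := fun h => hn ((hadj u v).2 (Or.inl h))
    obtain ⟨L, hL, -, hadjL, -, hLv, hdegL, hk'⟩ := exists_add hC.closed hK hu huv hnK hKu hKv
    have c1' := hk' 1
    have c2' := hk' 2
    have c3' := hk' 3
    norm_num at c1' c2' c3'
    have hLr : L.vdeg r = 1 := by rw [hdegL r hru hvr.ne']; exact hKr
    have hnL : ¬ L.Adj v r := by
      rw [hadjL]
      rintro (h | ⟨h, -⟩ | ⟨-, h⟩)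
      · exact hnr ((hadj v r).2 (Or.inl h))
      · exact huv.ne' h
      · exact hru h
    obtain ⟨M, hM, -, -, -, -, -, hk''⟩ := exists_add hC.closed hL hv hvr hnL hLv hLr
    have c1'' := hk'' 1
    have c2'' := hk'' 2
    have c3'' := hk'' 3
    norm_num at c1'' c2'' c3''
    exact hC.attains_of_balanced hG hpar h33 h00 ha.le hM (by omega) (by omega) (by omega)
  -- Every edge at a degree-1 vertex, inside or outside `H`, now ends at degree 1, contradicting
  -- connectedness since degree 3 also occurs.
  exfalso
  obtain ⟨u, hu, v, hv, huv, hdu, hdv⟩ :=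
    hC.exists_cross (fun v => H.vdeg v = 1) hx hdx hs (by omega)
  by_cases hadj : H.Adj u v
  · have := hle v
    have := vdeg_pos hadj.symm
    have : H.vdeg v ≠ 3 := fun h => h13 ⟨u, hu, v, hadj, hdu, h⟩
    have : H.vdeg v ≠ 2 := fun h => h12' ⟨u, hu, v, hadj, hdu, h⟩
    omega
  · exact hdv (hout u hu v huv hadj hdu)

end SimpleGraph

/-! ### Starting subgraphs, and the targets on one component. -/

namespace SimpleGraph

variable {V : Type*} [Fintype V] {G H : SimpleGraph V} {C : Finset V}

theorem attains_zero (G : SimpleGraph V) (C : Finset V) : G.Attains C 0 0 0 :=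
  ⟨⊥, bot_le, cnt_bot C one_pos, cnt_bot C two_pos, cnt_bot C three_pos⟩

theorem Attains.compl (hG : ∀ v, G.vdeg v = 3) {a b c : ℕ} (h : G.Attains C a b c) :
    G.Attains C (C.card - c) (C.card - b) (C.card - a) := by
  obtain ⟨H, hH, h1, h2, h3⟩ := h
  have e1 := cnt_sdiff hG hH C (j := 1) (k := 3) rfl
  have e2 := cnt_sdiff hG hH C (j := 2) (k := 2) rfl
  have e3 := cnt_sdiff hG hH C (j := 3) (k := 1) rfl
  exact ⟨G \ H, sdiff_le, by omega, by omega, by omega⟩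

/-- The star at `v`. -/
theorem exists_star (hC : G.AdjClosed C) (hG : ∀ v, G.vdeg v = 3) {v : V} (hv : v ∈ C) :
    G.Attains C 2 0 0 ∧ G.Attains C 3 1 0 ∧ G.Attains C 4 2 0 ∧
    ∃ H ≤ G, H.cnt C 1 = 4 ∧ H.cnt C 2 = 1 ∧ H.cnt C 3 = 1 ∧ H.vdeg v = 3 ∧
      (∀ a b, H.Adj a b → a = v ∨ b = v) ∧ ∀ a, H.Adj v a → H.vdeg a = 1 := by
  have b1 : (⊥ : SimpleGraph V).cnt C 1 = 0 := cnt_bot C one_pos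
  have b2 : (⊥ : SimpleGraph V).cnt C 2 = 0 := cnt_bot C two_pos
  have b3 : (⊥ : SimpleGraph V).cnt C 3 = 0 := cnt_bot C three_pos
  obtain ⟨x, hvx, hnx⟩ := exists_out (G := G) (H := ⊥) (u := v) (by rw [hG, vdeg_bot]; omega)
  obtain ⟨H1, hH1, -, hadj1, hdv1, hdx1, hdeg1, hk1⟩ :=
    exists_add hC bot_le hv hvx hnx (vdeg_bot v) (vdeg_bot x)
  obtain ⟨y, hvy, hny⟩ := exists_out (G := G) (H := H1) (u := v) (by rw [hG]; omega)
  have hyx : y ≠ x := by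
    rintro rfl
    exact hny ((hadj1 _ _).2 (by simp))
  have hdy1 : H1.vdeg y = 0 := by rw [hdeg1 y hvy.ne' hyx, vdeg_bot]
  obtain ⟨H2, hH2, -, hadj2, hdv2, hdy2, hdeg2, hk2⟩ := exists_add hC hH1 hv hvy hny hdv1 hdy1
  obtain ⟨z, hvz, hnz⟩ := exists_out (G := G) (H := H2) (u := v) (by rw [hG]; omega)
  have hzx : z ≠ x := by
    rintro rfl
    exact hnz ((hadj2 _ _).2 (Or.inl ((hadj1 _ _).2 (by simp))))
  have hzy : z ≠ y := by
    rintro rfl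
    exact hnz ((hadj2 _ _).2 (by simp))
  have hdz2 : H2.vdeg z = 0 := by
    rw [hdeg2 z hvz.ne' hzy, hdeg1 z hvz.ne' hzx, vdeg_bot]
  have hdx2 : H2.vdeg x = 1 := by rw [hdeg2 x hvx.ne' hyx.symm, hdx1]
  obtain ⟨H3, hH3, -, hadj3, hdv3, hdz3, hdeg3, hk3⟩ := exists_add hC hH2 hv hvz hnz hdv2 hdz2
  -- Avoiding `y` prevents closing a triangle: `w x v y` is a path with counts `(4, 2, 0)`.
  obtain ⟨w, hwy, hxw, hnw⟩ := exists_out_ne (G := G) (H := H2) (u := x) (by rw [hG]; omega) y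
  have hwv : w ≠ v := by
    rintro rfl
    exact hnw ((hadj2 _ _).2 (Or.inl ((hadj1 _ _).2 (by simp))))
  have hdw2 : H2.vdeg w = 0 := by
    rw [hdeg2 w hwv hwy, hdeg1 w hwv hxw.ne', vdeg_bot]
  obtain ⟨H4, hH4, -, -, -, -, -, hk4⟩ :=
    exists_add hC hH2 (hC v hv x hvx) hxw hnw hdx2 hdw2
  have c11 := hk1 1
  have c12 := hk1 2
  have c13 := hk1 3
  have c21 := hk2 1
  have c22 := hk2 2
  have c23 := hk2 3
  have c31 := hk3 1
  have c32 := hk3 2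
  have c33 := hk3 3
  have c41 := hk4 1
  have c42 := hk4 2
  have c43 := hk4 3
  norm_num at c11 c12 c13 c21 c22 c23 c31 c32 c33 c41 c42 c43
  refine ⟨⟨H1, hH1, by omega, by omega, by omega⟩, ⟨H2, hH2, by omega, by omega, by omega⟩,
    ⟨H4, hH4, by omega, by omega, by omega⟩, H3, hH3, by omega, by omega, by omega, hdv3, ?_, ?_⟩
  · intro a b
    rw [hadj3, hadj2, hadj1]
    simp only [bot_adj]
    tauto
  · intro a
    rw [hadj3, hadj2, hadj1]
    simp only [bot_adj, hvz.ne, hvy.ne, hvx.ne, true_and, false_and, or_false, false_or]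
    rintro ((rfl | rfl) | rfl)
    · rw [hdeg3 _ hvx.ne' hzx.symm, hdx2]
    · rw [hdeg3 _ hvy.ne' hzy.symm, hdy2]
    · exact hdz3

theorem attains_paw (hC : G.AdjClosed C) (hG : ∀ v, G.vdeg v = 3) {u v w : V} (hu : u ∈ C)
    (huv : G.Adj u v) (hvw : G.Adj v w) (huw : G.Adj u w) : G.Attains C 4 3 1 := by
  obtain ⟨-, -, -, H, hH, h1, h2, h3, hdu, hadj, hleaf⟩ := exists_star hC hG hu
  have hn : ¬ H.Adj v w := by
    intro h
    rcases hadj v w h with rfl | rfl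
    · exact huv.ne rfl
    · exact huw.ne rfl
  obtain ⟨K, hK, -, -, -, -, -, hk⟩ := exists_add hC hH (hC u hu v huv) hvw hn
    (hleaf v (adj_of_vdeg_eq_three hG hH hdu huv)) (hleaf w (adj_of_vdeg_eq_three hG hH hdu huw))
  have c1 := hk 1
  have c2 := hk 2
  have c3 := hk 3
  norm_num at c1 c2 c3
  exact ⟨K, hK, by omega, by omega, by omega⟩

/-- A sparse subgraph with about `k` vertices of degree `3` and almost none of degree `2`. -/
theorem AdjConn.exists_sparse (hC : G.AdjConn C) (hG : ∀ v, G.vdeg v = 3) {k : ℕ} (hk : 0 < k)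
    (hkC : k < C.card) : ∃ H ≤ G,
      (H.cnt C 3 = k ∧ H.cnt C 2 = k ∧ H.cnt C 1 ≤ 2 * k + 2) ∨
      (H.cnt C 3 = k ∧ H.cnt C 1 ≤ H.cnt C 2 + k ∧ H.cnt C 2 ≤ k + 2) ∨
      (H.cnt C 3 = k + 1 ∧ H.cnt C 2 = k + 1 ∧ H.cnt C 1 ≤ 2 * k) := by
  obtain ⟨v0, hv0⟩ := hC.nonempty
  -- With `q` vertices of degree 3, the first alternative allows `q + 2` of degree 1 and one of
  -- degree 2; the second allows `q` and two. Growth from a star completes a degree-2 vertex if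
  -- there is one, and otherwise extends a degree-1 vertex.
  have hstar : ∃ H : SimpleGraph V, H ≤ G ∧ 0 < H.cnt C 3 ∧
      ((H.cnt C 1 ≤ H.cnt C 2 + H.cnt C 3 + 2 ∧ H.cnt C 2 ≤ H.cnt C 3 + 1 ∧ H.cnt C 2 ≤ k) ∨
        (H.cnt C 1 ≤ H.cnt C 2 + H.cnt C 3 ∧ H.cnt C 2 ≤ H.cnt C 3 + 2 ∧ H.cnt C 3 ≤ k)) := by
    obtain ⟨-, -, -, H, hH, h1, h2, h3, -⟩ := exists_star hC.closed hG hv0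
    exact ⟨H, hH, by omega, Or.inl ⟨by omega, by omega, by omega⟩⟩
  obtain ⟨H, ⟨hH, hpos, hreg⟩, hmax⟩ := exists_maximal_graph hstar
  have hle := vdeg_le_three hG hH
  have h23 := H.cnt_anti C (show 2 ≤ 3 by omega)
  have h12 := H.cnt_anti C (show 1 ≤ 2 by omega)
  by_cases hk3 : H.cnt C 3 = k
  · rcases hreg with hreg | hreg
    · exact ⟨H, hH, Or.inl ⟨by omega, by omega, by omega⟩⟩
    · exact ⟨H, hH, Or.inr (Or.inl ⟨by omega, by omega, by omega⟩)⟩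
  by_cases hn2 : H.cnt C 2 = H.cnt C 3
  · by_cases hn1 : H.cnt C 1 = H.cnt C 2
    · exfalso
      obtain ⟨z, hz, hdz⟩ := exists_vdeg_eq (H := H) (C := C) (k := 0)
        (by rw [cnt_zero, zero_add]; omega)
      obtain ⟨s, hs⟩ := Finset.card_pos.1 (show 0 < H.cnt C 3 by omega)
      rw [Finset.mem_filter] at hs
      obtain ⟨u, hu, v, hv, huv, hdu, hdv⟩ :=
        hC.exists_cross (fun v => 3 ≤ H.vdeg v) hs.1 hs.2 hz (by omega)
      have huv' := adj_of_vdeg_eq_three hG hH (le_antisymm (hle u) hdu) huv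
      have := vdeg_pos huv'.symm
      have : H.vdeg v = 1 ∨ H.vdeg v = 2 := by omega
      rcases this with h | h
      · have := cnt_succ_lt hv h
        norm_num at this
        omega
      · have := cnt_succ_lt hv h
        norm_num at this
        omega
    · obtain ⟨x, hx, hdx⟩ := exists_vdeg_eq (H := H) (C := C) (k := 1) (by norm_num; omega)
      obtain ⟨y, hxy, hn⟩ := exists_out (G := G) (H := H) (u := x) (by rw [hG]; omega)
      have hy := hC.closed x hx y hxy
      have := hle y
      have : H.vdeg y ≠ 3 := fun h => hn (adj_of_vdeg_eq_three hG hH h hxy.symm).symm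
      have : H.vdeg y ≠ 2 := by
        intro h
        have := cnt_succ_lt hy h
        norm_num at this
        omega
      have : H.vdeg y = 0 ∨ H.vdeg y = 1 := by omega
      rcases this with hdy | hdy
      all_goals
        obtain ⟨K, hK, hlt, -, -, -, -, hc⟩ := exists_add hC.closed hH hx hxy hn hdx hdy
        have c1 := hc 1
        have c2 := hc 2
        have c3 := hc 3
        norm_num at c1 c2 c3
        exact absurd hlt (hmax K ⟨hK, by omega, by omega⟩)
  · obtain ⟨x, hx, hdx⟩ := exists_vdeg_eq (H := H) (C := C) (k := 2) (by norm_num; omega)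
    obtain ⟨y, hxy, hn⟩ := exists_out (G := G) (H := H) (u := x) (by rw [hG]; omega)
    have := hle y
    have : H.vdeg y ≠ 3 := fun h => hn (adj_of_vdeg_eq_three hG hH h hxy.symm).symm
    have : H.vdeg y = 0 ∨ H.vdeg y = 1 ∨ H.vdeg y = 2 := by omega
    rcases this with hdy | hdy | hdy
    all_goals
      obtain ⟨K, hK, hlt, -, -, -, -, hc⟩ := exists_add hC.closed hH hx hxy hn hdx hdy
      have c1 := hc 1
      have c2 := hc 2
      have c3 := hc 3
      norm_num at c1 c2 c3
      have := K.cnt_anti C (show 2 ≤ 3 by omega)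
    · exact absurd hlt (hmax K ⟨hK, by omega, by omega⟩)
    · exact absurd hlt (hmax K ⟨hK, by omega, by omega⟩)
    · by_cases hk1 : H.cnt C 3 + 2 ≤ k
      · exact absurd hlt (hmax K ⟨hK, by omega, by omega⟩)
      -- A 2–2 edge added at `cnt 3 = k - 1` overshoots to `k + 1`: the third outcome.
      · exact ⟨K, hK, Or.inr (Or.inr ⟨by omega, by omega, by omega⟩)⟩

/-- If vertices of degree `1` are joined outside `H` to vertices of degree `0` only, some vertex of
degree `0` has many neighbours of degree `1`. -/
theorem exists_zero_with_ones (hC : G.AdjClosed C) (hG : ∀ v, G.vdeg v = 3) (hH : H ≤ G)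
    (hout : ∀ u ∈ C, ∀ v, G.Adj u v → ¬ H.Adj u v → H.vdeg u = 1 → H.vdeg v = 0) {m : ℕ}
    (hm : m * (C.card - H.cnt C 1) < 2 * (H.cnt C 1 - H.cnt C 2)) :
    ∃ w ∈ C, H.vdeg w = 0 ∧ ∃ S : Finset V, m < S.card ∧
      ∀ x ∈ S, x ∈ C ∧ H.vdeg x = 1 ∧ G.Adj w x := by
  classical
  by_contra! hcon
  have e0 := card_vdeg_eq H C 0
  have e1 := card_vdeg_eq H C 1
  rw [cnt_zero] at e0
  norm_num at e0 e1
  have := Finset.card_mul_le_card_mul (s := C.filter fun v => H.vdeg v = 1)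
    (t := C.filter fun v => H.vdeg v = 0) G.Adj (m := 2) (n := m) ?_ ?_
  · have h0 : (C.filter fun v => H.vdeg v = 0).card = C.card - H.cnt C 1 := by omega
    have h1 : (C.filter fun v => H.vdeg v = 1).card = H.cnt C 1 - H.cnt C 2 := by omega
    rw [h0, h1, mul_comm, mul_comm _ m] at this
    omega
  · intro x hx
    rw [Finset.mem_filter] at hx
    have h := vdeg_sdiff hH x
    rw [hG, hx.2] at h
    have h' : (G \ H).vdeg x = 2 := by omega
    rw [← h']
    unfold vdeg
    apply Finset.card_le_card
    intro y
    simp only [Finset.mem_filter, Finset.mem_univ, true_and, sdiff_adj,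
      Finset.mem_bipartiteAbove]
    exact fun hy => ⟨⟨hC x hx.1 y hy.1, hout x hx.1 y hy.1 hy.2 hx.2⟩, hy.1⟩
  · intro w hw
    rw [Finset.mem_filter] at hw
    by_contra! hlt
    obtain ⟨x, hx, hx'⟩ := hcon w hw.1 hw.2 _ hlt
    rw [Finset.mem_bipartiteBelow, Finset.mem_filter] at hx
    exact hx' hx.1.1 hx.1.2 hx.2.symm

/-- Treats the extreme first outcome of `exists_sparse`: `k + 2` vertices of degree 1, two more than
wanted, and none of degree 2. Two of them are joined directly or through a common degree-0
neighbour. In the latter case their `2 * (k + 2)` outside edges all end at degree-0 vertices, at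
most three at each; the recorded inequality later rules out the 8-vertex case where `k + 3` is too
large. -/
theorem exists_fewer_ones (hC : G.AdjClosed C) (hG : ∀ v, G.vdeg v = 3) (hH : H ≤ G) {k : ℕ}
    (h3 : H.cnt C 3 = k) (h2 : H.cnt C 2 = k) (h1 : H.cnt C 1 = 2 * k + 2)
    (hkC : C.card < 4 * k + 6) :
    ∃ K ≤ G, K.cnt C 3 = k ∧ K.cnt C 1 ≤ K.cnt C 2 + k ∧
      (K.cnt C 2 = k + 2 ∨ K.cnt C 2 = k + 3 ∧ 2 * (k + 2) ≤ 3 * (C.card - (2 * k + 2))) := by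
  have hle := vdeg_le_three hG hH
  by_cases h11 : ∃ u ∈ C, ∃ v, G.Adj u v ∧ ¬ H.Adj u v ∧ H.vdeg u = 1 ∧ H.vdeg v = 1
  · obtain ⟨u, hu, v, huv, hn, hdu, hdv⟩ := h11
    obtain ⟨K, hK, -, -, -, -, -, hc⟩ := exists_add hC hH hu huv hn hdu hdv
    have c1 := hc 1
    have c2 := hc 2
    have c3 := hc 3
    norm_num at c1 c2 c3
    exact ⟨K, hK, by omega, by omega, Or.inl (by omega)⟩
  have hout : ∀ u ∈ C, ∀ v, G.Adj u v → ¬ H.Adj u v → H.vdeg u = 1 → H.vdeg v = 0 := by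
    intro u hu v huv hn hdu
    have := hle v
    have : H.vdeg v ≠ 3 := fun h => hn (adj_of_vdeg_eq_three hG hH h huv.symm).symm
    have : H.vdeg v ≠ 1 := fun h => h11 ⟨u, hu, v, huv, hn, hdu, h⟩
    have : H.vdeg v ≠ 2 := by
      intro h
      have := cnt_succ_lt (hC u hu v huv) h
      norm_num at this
      omega
    omega
  have hbound : 2 * (k + 2) ≤ 3 * (C.card - (2 * k + 2)) := by
    by_contra! hlt
    obtain ⟨w, hw, -, S, hS, hSw⟩ := exists_zero_with_ones hC hG hH hout (m := 3) (by
      rw [h1, h2]; omega)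
    have : S.card ≤ G.vdeg w := by
      classical
      apply Finset.card_le_card
      intro x hx
      simpa using (hSw x hx).2.2
    rw [hG] at this
    omega
  -- By `hkC`, fewer than `2 * k + 4` degree-0 vertices receive these edges, so one receives two.
  obtain ⟨w, hw, hdw, S, hS, hSw⟩ := exists_zero_with_ones hC hG hH hout (m := 1) (by
    rw [h1, h2]; omega)
  obtain ⟨x, hx, y, hy, hxy⟩ := Finset.one_lt_card.1 hS
  obtain ⟨hxC, hdx, hwx⟩ := hSw x hx
  obtain ⟨hyC, hdy, hwy⟩ := hSw y hy
  have hnwx : ¬ H.Adj w x := fun h => by have := vdeg_pos h; omega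
  have hnwy : ¬ H.Adj w y := fun h => by have := vdeg_pos h; omega
  obtain ⟨K, hK, -, hadj, hKw, -, hdeg, hc⟩ := exists_add hC hH hw hwx hnwx hdw hdx
  have hKy : K.vdeg y = 1 := by rw [hdeg y hwy.ne' hxy.symm]; exact hdy
  have hnK : ¬ K.Adj w y := by
    rw [hadj]
    rintro (h | ⟨-, h⟩ | ⟨h, -⟩)
    · exact hnwy h
    · exact hxy h.symm
    · exact hwx.ne h
  obtain ⟨L, hL, -, -, -, -, -, hc'⟩ := exists_add hC hK hw hwy hnK hKw hKy
  have c1 := hc 1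
  have c2 := hc 2
  have c3 := hc 3
  have c1' := hc' 1
  have c2' := hc' 2
  have c3' := hc' 3
  norm_num at c1 c2 c3 c1' c2' c3'
  exact ⟨L, hL, by omega, by omega, Or.inr ⟨by omega, hbound⟩⟩

theorem four_le_card (hC : G.AdjClosed C) (hG : ∀ v, G.vdeg v = 3) (hne : C.Nonempty) :
    4 ≤ C.card := by
  obtain ⟨v, hv⟩ := hne
  obtain ⟨-, -, -, H, -, h1, -⟩ := exists_star hC hG hv
  have := H.cnt_le_card C 1
  omega

theorem even_card (hC : G.AdjClosed C) (hG : ∀ v, G.vdeg v = 3) : Even C.card := by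
  have h := even_sum_vdeg hC
  simp only [hG, Finset.sum_const, smul_eq_mul] at h
  rw [Nat.even_mul] at h
  rcases h with h | h
  · exact h
  · exact absurd h (by decide)

/-- All the degree distributions of the theorem occur on `C`. -/
def Good (G : SimpleGraph V) (C : Finset V) : Prop :=
  (∃ s, C.card = 4 * s + 4 ∧ G.Attains C (3 * s + 3) (2 * s + 2) (s + 1) ∧
    G.Attains C (3 * s + 2) (2 * s) s) ∨
  ∃ s, C.card = 4 * s + 6 ∧ G.Attains C (3 * s + 4) (2 * s + 3) (s + 1) ∧
    G.Attains C (3 * s + 3) (2 * s + 1) s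

/-- The cap `a - b` is `s + 2`, just enough for `exists_sparse` with `k = s`. For `s = 0` the target
has no vertex of degree 3, and an edge or a path serves. -/
theorem AdjConn.attains_shifted (hC : G.AdjConn C) (hG : ∀ v, G.vdeg v = 3) {s : ℕ} :
    (C.card = 4 * s + 4 → G.Attains C (3 * s + 2) (2 * s) s) ∧
    (C.card = 4 * s + 6 → G.Attains C (3 * s + 3) (2 * s + 1) s) := by
  obtain ⟨v, hv⟩ := hC.nonempty
  obtain ⟨hedge, hpath, -, K, hK, hK1, hK2, hK3, -⟩ := exists_star hC.closed hG hv
  rcases Nat.eq_zero_or_pos s with rfl | hs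
  · exact ⟨fun _ => hedge, fun _ => hpath⟩
  constructor
  · intro hcard
    apply hC.attains_of_region hG _ (by omega) (by omega) (by omega) (by omega) hs
    -- On 8 vertices `exists_sparse` may give `cnt 2 = 3 > 2 * s`; the star fits instead.
    · rcases eq_or_ne s 1 with rfl | hs1
      · exact ⟨K, hK, by omega, by omega, by omega⟩
      obtain ⟨H, hH, h⟩ := hC.exists_sparse hG hs (by omega)
      exact ⟨H, hH, by omega, by omega, by omega⟩
    · rw [Nat.even_iff]; omega
  · intro hcard
    apply hC.attains_of_region hG _ (by omega) (by omega) (by omega) (by omega) hs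
    · obtain ⟨H, hH, h⟩ := hC.exists_sparse hG hs (by omega)
      exact ⟨H, hH, by omega, by omega, by omega⟩
    · rw [Nat.even_iff]; omega

/-- The cap is `s + 1 = k`. By parity the only sparse outcome above it has `k + 2` vertices of
degree 1, which `exists_fewer_ones` handles. -/
theorem AdjConn.attains_centered (hC : G.AdjConn C) (hG : ∀ v, G.vdeg v = 3) {s : ℕ}
    (hs : 0 < s) :
    (C.card = 4 * s + 4 → G.Attains C (3 * s + 3) (2 * s + 2) (s + 1)) ∧
    (C.card = 4 * s + 6 → G.Attains C (3 * s + 4) (2 * s + 3) (s + 1)) := by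
  have key : C.card = 4 * s + 4 ∨ C.card = 4 * s + 6 →
      ∃ H ≤ G, s + 1 ≤ H.cnt C 3 ∧ H.cnt C 1 ≤ H.cnt C 2 + (s + 1) ∧
        (H.cnt C 2 ≤ s + 3 ∨ H.cnt C 2 = s + 4 ∧ 2 * (s + 3) ≤ 3 * (C.card - (2 * s + 4))) := by
    intro hcard
    obtain ⟨H, hH, h⟩ := hC.exists_sparse hG (k := s + 1) (by omega) (by omega)
    by_cases hb : H.cnt C 3 = s + 1 ∧ H.cnt C 2 = s + 1 ∧ H.cnt C 1 = 2 * (s + 1) + 2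
    · obtain ⟨K, hK, k3, k1, k2⟩ := exists_fewer_ones hC.closed hG hH hb.1 hb.2.1 hb.2.2 (by omega)
      exact ⟨K, hK, by omega, by omega, by omega⟩
    · have := even_cnt hC.closed hG hH
      rw [Nat.even_iff] at this
      exact ⟨H, hH, by omega, by omega, by omega⟩
  constructor
  · intro hcard
    obtain ⟨H, hH, h⟩ := key (Or.inl hcard)
    apply hC.attains_of_region hG _ (by omega) (by omega) (by omega) (by omega) (by omega)
    · exact ⟨H, hH, by omega, by omega, by omega⟩
    · rw [Nat.even_iff]; omega
  · intro hcard
    obtain ⟨H, hH, h⟩ := key (Or.inr hcard)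
    apply hC.attains_of_region hG _ (by omega) (by omega) (by omega) (by omega) (by omega)
    · exact ⟨H, hH, by omega, by omega, by omega⟩
    · rw [Nat.even_iff]; omega

/-- `C` has the size of `K₃,₃` and spans no triangle. -/
def IsTriangleFreeSix (G : SimpleGraph V) (C : Finset V) : Prop :=
  C.card = 6 ∧ ∀ u ∈ C, ∀ v w, G.Adj u v → G.Adj v w → ¬ G.Adj u w

theorem AdjConn.good_or (hC : G.AdjConn C) (hG : ∀ v, G.vdeg v = 3) :
    G.Good C ∨ C.card = 4 ∨ G.IsTriangleFreeSix C := by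
  have h4 := four_le_card hC.closed hG hC.nonempty
  have he := even_card hC.closed hG
  rw [Nat.even_iff] at he
  by_cases hc4 : C.card = 4
  · exact Or.inr (Or.inl hc4)
  by_cases hc6 : C.card = 6
  · by_cases ht : ∀ u ∈ C, ∀ v w, G.Adj u v → G.Adj v w → ¬ G.Adj u w
    · exact Or.inr (Or.inr ⟨hc6, ht⟩)
    · push Not at ht
      obtain ⟨u, hu, v, w, huv, hvw, huw⟩ := ht
      exact Or.inl (Or.inr ⟨0, hc6, attains_paw hC.closed hG hu huv hvw huw,
        (hC.attains_shifted hG).2 hc6⟩)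
  · left
    rcases (show C.card % 4 = 0 ∨ C.card % 4 = 2 by omega) with h | h
    · have hs : C.card = 4 * (C.card / 4 - 1) + 4 := by omega
      exact Or.inl ⟨_, hs, (hC.attains_centered hG (by omega)).1 hs, (hC.attains_shifted hG).1 hs⟩
    · have hs : C.card = 4 * (C.card / 4 - 1) + 6 := by omega
      exact Or.inr ⟨_, hs, (hC.attains_centered hG (by omega)).2 hs, (hC.attains_shifted hG).2 hs⟩

end SimpleGraph

/-! ### Gluing components. -/

namespace SimpleGraph

open Finset

section

variable {V : Type*} {G : SimpleGraph V} {C D : Finset V}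

theorem AdjClosed.union [DecidableEq V] (hC : G.AdjClosed C) (hD : G.AdjClosed D) :
    G.AdjClosed (C ∪ D) := by
  intro u hu v huv
  rw [mem_union] at hu ⊢
  exact hu.imp (fun h => hC u h v huv) fun h => hD u h v huv

theorem AdjClosed.sdiff [DecidableEq V] (hC : G.AdjClosed C) (hD : G.AdjClosed D) :
    G.AdjClosed (C \ D) := by
  intro u hu v huv
  rw [mem_sdiff] at hu ⊢
  exact ⟨hC u hu.1 v huv, fun h => hu.2 (hD v h u huv.symm)⟩

theorem AdjClosed.exists_adjConn (hC : G.AdjClosed C) (hne : C.Nonempty) :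
    ∃ D ⊆ C, G.AdjConn D := by
  classical
  induction hn : C.card using Nat.strong_induction_on generalizing C with
  | _ n ih =>
  by_cases h : ∃ D ⊂ C, G.AdjClosed D ∧ D.Nonempty
  · obtain ⟨D, hDC, hD, hDne⟩ := h
    obtain ⟨E, hE, hE'⟩ := ih _ (hn ▸ card_lt_card hDC) hD hDne rfl
    exact ⟨E, hE.trans hDC.1, hE'⟩
  · push Not at h
    refine ⟨C, subset_rfl, hC, hne, fun D hDC hD hDne => ?_⟩
    by_contra hDC'
    exact hDne.ne_empty (by simpa using h D (hDC.ssubset_of_ne hDC') hD)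

end

section

variable {V : Type*} [DecidableEq V] {G : SimpleGraph V} {C D : Finset V}

/-- `C` is the union of `k` components with four vertices each. -/
def IsUnionFour (G : SimpleGraph V) (k : ℕ) (C : Finset V) : Prop :=
  ∃ f : Fin k → Finset V, (∀ i, G.AdjClosed (f i) ∧ (f i).card = 4) ∧
    (∀ i j, i ≠ j → Disjoint (f i) (f j)) ∧ C = univ.biUnion f

theorem IsUnionFour.closed {k : ℕ} (h : G.IsUnionFour k C) : G.AdjClosed C := by
  obtain ⟨f, hf, -, rfl⟩ := h
  intro u hu v huv
  rw [mem_biUnion] at hu ⊢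
  obtain ⟨i, hi, hu⟩ := hu
  exact ⟨i, hi, (hf i).1 u hu v huv⟩

theorem IsUnionFour.card {k : ℕ} (h : G.IsUnionFour k C) : C.card = 4 * k := by
  obtain ⟨f, hf, hdis, rfl⟩ := h
  rw [card_biUnion fun i _ j _ hij => hdis i j hij]
  simp [(hf _).2, mul_comm]

theorem IsUnionFour.exists_cons {k : ℕ} (h : G.IsUnionFour (k + 1) C) :
    ∃ A B, G.AdjClosed A ∧ A.card = 4 ∧ G.IsUnionFour k B ∧ Disjoint A B ∧ C = A ∪ B := by
  obtain ⟨f, hf, hdis, rfl⟩ := h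
  refine ⟨f 0, univ.biUnion fun i : Fin k => f i.succ, (hf 0).1, (hf 0).2,
    ⟨_, fun i => hf _, fun i j hij => hdis _ _ (by simpa using hij), rfl⟩, ?_, ?_⟩
  · rw [disjoint_biUnion_right]
    exact fun i _ => hdis _ _ (Fin.succ_ne_zero i).symm
  · ext v
    simp [Fin.exists_fin_succ]

theorem IsUnionFour.cons {k : ℕ} (hC : G.AdjClosed C) (h4 : C.card = 4) (h : G.IsUnionFour k D)
    (hCD : Disjoint C D) : G.IsUnionFour (k + 1) (C ∪ D) := by
  obtain ⟨f, hf, hdis, rfl⟩ := h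
  rw [disjoint_biUnion_right] at hCD
  refine ⟨Fin.cons C f, ?_, ?_, ?_⟩
  · intro i
    refine Fin.cases ?_ (fun i => ?_) i
    · exact ⟨hC, h4⟩
    · exact hf i
  · intro i j
    refine Fin.cases ?_ (fun i => ?_) i <;> refine Fin.cases ?_ (fun j => ?_) j
    · exact fun h => absurd rfl h
    · exact fun _ => hCD j (mem_univ j)
    · exact fun _ => (hCD i (mem_univ i)).symm
    · exact fun h => hdis i j fun h' => h (congrArg _ h')
  · ext v
    simp [Fin.exists_fin_succ]

end

variable {V : Type*} [Fintype V] {G : SimpleGraph V} {C D : Finset V}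

theorem Attains.union [DecidableEq V] (hC : G.AdjClosed C) (hD : G.AdjClosed D)
    (hCD : Disjoint C D) {a b c a' b' c' : ℕ} (h : G.Attains C a b c)
    (h' : G.Attains D a' b' c') : G.Attains (C ∪ D) (a + a') (b + b') (c + c') := by
  classical
  obtain ⟨H, hH, h1, h2, h3⟩ := h
  obtain ⟨K, hK, k1, k2, k3⟩ := h'
  let L : SimpleGraph V :=
    { Adj := fun u v => (u ∈ C ∧ H.Adj u v) ∨ (u ∈ D ∧ K.Adj u v)
      symm := ⟨by
        rintro u v (⟨hu, huv⟩ | ⟨hu, huv⟩)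
        · exact Or.inl ⟨hC u hu v (hH huv), huv.symm⟩
        · exact Or.inr ⟨hD u hu v (hK huv), huv.symm⟩⟩
      loopless := ⟨by
        rintro u (⟨-, huv⟩ | ⟨-, huv⟩)
        · exact huv.ne rfl
        · exact huv.ne rfl⟩ }
  have hLC : ∀ v ∈ C, L.vdeg v = H.vdeg v := by
    intro v hv
    have hv' := Finset.disjoint_left.1 hCD hv
    unfold vdeg
    congr 1
    ext w
    simp [L, hv, hv']
  have hLD : ∀ v ∈ D, L.vdeg v = K.vdeg v := by
    intro v hv
    have hv' := Finset.disjoint_right.1 hCD hv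
    unfold vdeg
    congr 1
    ext w
    simp [L, hv, hv']
  have hcnt : ∀ k, L.cnt (C ∪ D) k = H.cnt C k + K.cnt D k := by
    intro k
    unfold cnt
    rw [filter_union, card_union_of_disjoint (disjoint_filter_filter hCD)]
    congr 2
    · exact filter_congr fun v hv => by rw [hLC v hv]
    · exact filter_congr fun v hv => by rw [hLD v hv]
  refine ⟨L, ?_, by rw [hcnt, h1, k1], by rw [hcnt, h2, k2], by rw [hcnt, h3, k3]⟩
  rintro u v (⟨-, h⟩ | ⟨-, h⟩)
  · exact hH h
  · exact hK h

theorem Attains.congr {a b c a' b' c' : ℕ} (h : G.Attains C a b c) (ha : a = a') (hb : b = b')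
    (hc : c = c') : G.Attains C a' b' c' := by
  subst ha hb hc
  exact h

/-- Subgraphs occurring on every component with four vertices. -/
theorem attains_of_card_four (hC : G.AdjClosed C) (hG : ∀ v, G.vdeg v = 3) (h4 : C.card = 4) :
    G.Attains C 2 0 0 ∧ G.Attains C 4 4 2 ∧ G.Attains C 3 1 0 ∧ G.Attains C 4 1 1 ∧
      G.Attains C 4 3 1 := by
  obtain ⟨v, hv⟩ := card_pos.1 (show 0 < C.card by omega)
  obtain ⟨hedge, hpath, -, H, hH, h1, h2, h3, hdv, hadj, hleaf⟩ := exists_star hC hG hv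
  refine ⟨hedge, hedge.compl hG |>.congr (by omega) (by omega) (by omega), hpath,
    ⟨H, hH, h1, h2, h3⟩, ?_⟩
  obtain ⟨x, hx, hdx⟩ := exists_vdeg_eq (H := H) (C := C) (k := 1) (by norm_num; omega)
  obtain ⟨y, hxy, hn⟩ := exists_out (G := G) (H := H) (u := x) (by rw [hG]; omega)
  have hy := hC x hx y hxy
  have hdy : H.vdeg y = 1 := by
    have := vdeg_le_three hG hH y
    have : H.vdeg y ≠ 3 := fun h => hn (adj_of_vdeg_eq_three hG hH h hxy.symm).symm
    have : H.vdeg y ≠ 2 := by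
      intro h
      have := cnt_succ_lt hy h
      norm_num at this
      omega
    have : H.vdeg y ≠ 0 := by
      intro h
      have := cnt_succ_lt hy h
      rw [cnt_zero, zero_add] at this
      omega
    omega
  obtain ⟨K, hK, -, -, -, -, -, hk⟩ := exists_add hC hH hx hxy hn hdx hdy
  have c1 := hk 1
  have c2 := hk 2
  have c3 := hk 3
  norm_num at c1 c2 c3
  exact ⟨K, hK, by omega, by omega, by omega⟩

/-- Subgraphs occurring on every component with six vertices. -/
theorem attains_of_card_six (hC : G.AdjClosed C) (hG : ∀ v, G.vdeg v = 3) (h6 : C.card = 6) :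
    G.Attains C 2 0 0 ∧ G.Attains C 3 1 0 ∧ G.Attains C 6 5 3 ∧ G.Attains C 6 4 2 := by
  obtain ⟨v, hv⟩ := card_pos.1 (show 0 < C.card by omega)
  obtain ⟨hedge, hpath, hpath', -⟩ := exists_star hC hG hv
  exact ⟨hedge, hpath, hpath.compl hG |>.congr (by omega) (by omega) (by omega),
    hpath'.compl hG |>.congr (by omega) (by omega) (by omega)⟩

section

variable [DecidableEq V]

/-- The triples add up directly unless both sizes are 2 modulo 4; then one summand is complemented,
turning `(3r+4, 2r+3, r+1)` into `(3r+5, 2r+3, r+2)`. -/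
theorem Good.union (hG : ∀ v, G.vdeg v = 3) (hC : G.AdjClosed C) (hD : G.AdjClosed D)
    (hCD : Disjoint C D) (h : G.Good C) (h' : G.Good D) : G.Good (C ∪ D) := by
  have hcard := card_union_of_disjoint hCD
  rcases h with ⟨s, hs, h1, h2⟩ | ⟨s, hs, h1, h2⟩ <;>
    rcases h' with ⟨r, hr, h3, h4⟩ | ⟨r, hr, h3, h4⟩
  · refine Or.inl ⟨s + r + 1, by omega, ?_, ?_⟩
    · exact (h1.union hC hD hCD h3).congr (by omega) (by omega) (by omega)
    · exact (h1.union hC hD hCD h4).congr (by omega) (by omega) (by omega)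
  · refine Or.inr ⟨s + r + 1, by omega, ?_, ?_⟩
    · exact (h1.union hC hD hCD h3).congr (by omega) (by omega) (by omega)
    · exact (h1.union hC hD hCD h4).congr (by omega) (by omega) (by omega)
  · refine Or.inr ⟨s + r + 1, by omega, ?_, ?_⟩
    · exact (h1.union hC hD hCD h3).congr (by omega) (by omega) (by omega)
    · exact (h2.union hC hD hCD h3).congr (by omega) (by omega) (by omega)
  · refine Or.inl ⟨s + r + 2, by omega, ?_, ?_⟩
    · exact (h1.union hC hD hCD (h3.compl hG)).congr (by omega) (by omega) (by omega)
    · exact (h2.union hC hD hCD (h3.compl hG)).congr (by omega) (by omega) (by omega)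

/-- A `K₄` swaps the two targets: the second plus `(4, 4, 2)` is the new first, and the first plus
`(2, 0, 0)` is the new second. -/
theorem Good.union_four (hG : ∀ v, G.vdeg v = 3) (hC : G.AdjClosed C) (hD : G.AdjClosed D)
    (hCD : Disjoint C D) (h : G.Good C) (h4 : D.card = 4) : G.Good (C ∪ D) := by
  have hcard := card_union_of_disjoint hCD
  obtain ⟨k1, k2, -⟩ := attains_of_card_four hD hG h4
  rcases h with ⟨s, hs, h1, h2⟩ | ⟨s, hs, h1, h2⟩
  · refine Or.inl ⟨s + 1, by omega, ?_, ?_⟩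
    · exact (h2.union hC hD hCD k2).congr (by omega) (by omega) (by omega)
    · exact (h1.union hC hD hCD k1).congr (by omega) (by omega) (by omega)
  · refine Or.inr ⟨s + 1, by omega, ?_, ?_⟩
    · exact (h2.union hC hD hCD k2).congr (by omega) (by omega) (by omega)
    · exact (h1.union hC hD hCD k1).congr (by omega) (by omega) (by omega)

/-- Only a three-vertex path and its complement are used on the six vertices, so `K₃,₃` is covered.
-/
theorem Good.union_six (hG : ∀ v, G.vdeg v = 3) (hC : G.AdjClosed C) (hD : G.AdjClosed D)
    (hCD : Disjoint C D) (h : G.Good C) (h6 : D.card = 6) : G.Good (C ∪ D) := by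
  have hcard := card_union_of_disjoint hCD
  obtain ⟨-, k1, k2, -⟩ := attains_of_card_six hD hG h6
  rcases h with ⟨s, hs, h1, h2⟩ | ⟨s, hs, h1, h2⟩
  · refine Or.inr ⟨s + 1, by omega, ?_, ?_⟩
    · exact ((h2.compl hG).union hC hD hCD k1).congr (by omega) (by omega) (by omega)
    · exact (h1.union hC hD hCD k1).congr (by omega) (by omega) (by omega)
  · refine Or.inl ⟨s + 2, by omega, ?_, ?_⟩
    · exact (h2.union hC hD hCD k2).congr (by omega) (by omega) (by omega)
    · exact ((h1.compl hG).union hC hD hCD k1).congr (by omega) (by omega) (by omega)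

theorem good_union_six_six (hG : ∀ v, G.vdeg v = 3) (hC : G.AdjClosed C) (hD : G.AdjClosed D)
    (hCD : Disjoint C D) (hC6 : C.card = 6) (hD6 : D.card = 6) : G.Good (C ∪ D) := by
  have hcard := card_union_of_disjoint hCD
  obtain ⟨k1, k2, k3, k4⟩ := attains_of_card_six hC hG hC6
  obtain ⟨l1, l2, l3, l4⟩ := attains_of_card_six hD hG hD6
  exact Or.inl ⟨2, by omega, k2.union hC hD hCD l3, k4.union hC hD hCD l1⟩

theorem good_union_four_six (hG : ∀ v, G.vdeg v = 3) (hC : G.AdjClosed C) (hD : G.AdjClosed D)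
    (hCD : Disjoint C D) (hC4 : C.card = 4) (hD6 : D.card = 6) : G.Good (C ∪ D) := by
  have hcard := card_union_of_disjoint hCD
  obtain ⟨-, k1, -, -, k2⟩ := attains_of_card_four hC hG hC4
  obtain ⟨l1, l2, -⟩ := attains_of_card_six hD hG hD6
  exact Or.inr ⟨1, by omega, k1.union hC hD hCD l2, k2.union hC hD hCD l1⟩

theorem IsUnionFour.attains_two (hG : ∀ v, G.vdeg v = 3) (h : G.IsUnionFour 2 C) :
    G.Attains C 6 4 2 := by
  obtain ⟨A, B, hA, hA4, hB, hAB, rfl⟩ := h.exists_cons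
  obtain ⟨k1, k2, -⟩ := attains_of_card_four hA hG hA4
  obtain ⟨l1, l2, -⟩ := attains_of_card_four hB.closed hG hB.card
  exact k1.union hA hB.closed hAB l2

theorem IsUnionFour.attains_three (hG : ∀ v, G.vdeg v = 3) (h : G.IsUnionFour 3 C) :
    G.Attains C 8 4 2 := by
  obtain ⟨A, B, hA, hA4, hB, hAB, rfl⟩ := h.exists_cons
  obtain ⟨k1, -⟩ := attains_of_card_four hA hG hA4
  exact k1.union hA hB.closed hAB (hB.attains_two hG)

/-- The exceptions end at four copies: `(12, 8, 4) = (4, 4, 2) + (8, 4, 2)` and `(11, 6, 3) = (4, 4,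
2) + (4, 1, 1) + (3, 1, 0) + (0, 0, 0)`. -/
theorem IsUnionFour.good_four (hG : ∀ v, G.vdeg v = 3) (h : G.IsUnionFour 4 C) : G.Good C := by
  have hcard := h.card
  obtain ⟨A, B, hA, hA4, hB, hAB, rfl⟩ := h.exists_cons
  refine Or.inl ⟨3, by omega, ?_, ?_⟩
  · obtain ⟨-, k2, -⟩ := attains_of_card_four hA hG hA4
    exact k2.union hA hB.closed hAB (hB.attains_three hG)
  · obtain ⟨-, k, -⟩ := attains_of_card_four hA hG hA4
    obtain ⟨A', B', hA', hA4', hB', hAB', rfl⟩ := hB.exists_cons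
    obtain ⟨-, -, -, k', -⟩ := attains_of_card_four hA' hG hA4'
    obtain ⟨A'', B'', hA'', hA4'', hB'', hAB'', rfl⟩ := hB'.exists_cons
    obtain ⟨-, -, k'', -⟩ := attains_of_card_four hA'' hG hA4''
    exact k.union hA hB.closed hAB (k'.union hA' hB'.closed hAB'
      (k''.union hA'' hB''.closed hAB'' (attains_zero G B'')))

theorem Good.union_isUnionFour (hG : ∀ v, G.vdeg v = 3) {k : ℕ} (hC : G.AdjClosed C)
    (hCD : Disjoint C D) (h : G.Good C) (hD : G.IsUnionFour k D) : G.Good (C ∪ D) := by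
  induction k generalizing D with
  | zero =>
    have : D = ∅ := card_eq_zero.1 hD.card
    simpa [this] using h
  | succ k ih =>
    obtain ⟨A, B, hA, hA4, hB, hAB, rfl⟩ := hD.exists_cons
    rw [disjoint_union_right] at hCD
    rw [union_comm A, ← union_assoc]
    exact (ih hCD.2 hB).union_four hG (hC.union hB.closed) hA
      (disjoint_union_left.2 ⟨hCD.1, hAB.symm⟩) hA4

theorem IsUnionFour.good_union_six (hG : ∀ v, G.vdeg v = 3) {k : ℕ}
    (hC : G.IsUnionFour (k + 1) C) (hD : G.AdjClosed D) (hCD : Disjoint C D) (hD6 : D.card = 6) :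
    G.Good (C ∪ D) := by
  obtain ⟨A, B, hA, hA4, hB, hAB, rfl⟩ := hC.exists_cons
  rw [disjoint_union_left] at hCD
  rw [union_assoc, union_comm B, ← union_assoc]
  exact (good_union_four_six hG hA hD hCD.1 hA4 hD6).union_isUnionFour hG (hA.union hD)
    (disjoint_union_left.2 ⟨hAB, hCD.2.symm⟩) hB

/-- Every nonempty union of components is good, a union of at most three copies of `K₄`, or
triangle-free with six vertices. -/
theorem AdjClosed.good_or (hG : ∀ v, G.vdeg v = 3) (hC : G.AdjClosed C) (hne : C.Nonempty) :
    G.Good C ∨ G.IsUnionFour 1 C ∨ G.IsUnionFour 2 C ∨ G.IsUnionFour 3 C ∨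
      G.IsTriangleFreeSix C := by
  induction hn : C.card using Nat.strong_induction_on generalizing C with
  | _ n ih =>
  obtain ⟨A, hAC, hA⟩ := hC.exists_adjConn hne
  have hAcl := hA.closed
  have hB := hC.sdiff hAcl
  have hdis : Disjoint A (C \ A) := disjoint_sdiff
  have hU : A ∪ (C \ A) = C := union_sdiff_of_subset hAC
  have hzero : G.IsUnionFour 0 ∅ := ⟨Fin.elim0, fun i => i.elim0, fun i => i.elim0, by simp⟩
  rcases (C \ A).eq_empty_or_nonempty with he | hBne
  · rw [he, union_empty] at hU
    subst hU
    rcases hA.good_or hG with h | h | h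
    · exact Or.inl h
    · exact Or.inr (Or.inl (by simpa using IsUnionFour.cons hAcl h hzero (disjoint_empty_right _)))
    · exact Or.inr (Or.inr (Or.inr (Or.inr h)))
  have hlt : (C \ A).card < n := hn ▸ card_lt_card (sdiff_ssubset hAC hA.nonempty)
  have hrest := ih _ hlt hB hBne rfl
  rw [← hU]
  generalize C \ A = B at hB hdis hrest
  rcases hA.good_or hG with h | h | h
  · left
    rcases hrest with h' | h' | h' | h' | h'
    · exact h.union hG hAcl hB hdis h'
    · exact h.union_isUnionFour hG hAcl hdis h'
    · exact h.union_isUnionFour hG hAcl hdis h'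
    · exact h.union_isUnionFour hG hAcl hdis h'
    · exact h.union_six hG hAcl hB hdis h'.1
  · rcases hrest with h' | h' | h' | h' | h'
    · rw [union_comm]
      exact Or.inl (h'.union_four hG hB hAcl hdis.symm h)
    · exact Or.inr (Or.inr (Or.inl (h'.cons hAcl h hdis)))
    · exact Or.inr (Or.inr (Or.inr (Or.inl (h'.cons hAcl h hdis))))
    · exact Or.inl ((h'.cons hAcl h hdis).good_four hG)
    · exact Or.inl (good_union_four_six hG hAcl hB hdis h h'.1)
  · left
    rw [union_comm]
    rcases hrest with h' | h' | h' | h' | h'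
    · exact h'.union_six hG hB hAcl hdis.symm h.1
    · exact h'.good_union_six hG hAcl hdis.symm h.1
    · exact h'.good_union_six hG hAcl hdis.symm h.1
    · exact h'.good_union_six hG hAcl hdis.symm h.1
    · exact good_union_six_six hG hB hAcl hdis.symm h'.1 h.1

end

end SimpleGraph

/-! ### Identifying the exceptional graphs and returning to exact degrees. -/

namespace SimpleGraph

open Finset

variable {V : Type*} [Fintype V] {G : SimpleGraph V}

theorem adj_of_card_four {C : Finset V} (hC : G.AdjClosed C) (hG : ∀ v, G.vdeg v = 3)
    (h4 : C.card = 4) {u v : V} (hu : u ∈ C) (hv : v ∈ C) (huv : u ≠ v) : G.Adj u v := by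
  classical
  have hs : univ.filter (G.Adj u) ⊆ C.erase u := by
    intro w
    simp only [mem_filter, mem_univ, true_and, mem_erase]
    exact fun hw => ⟨hw.ne', hC u hu w hw⟩
  have he := eq_of_subset_of_card_le hs (by
    rw [card_erase_of_mem hu, h4]
    exact (hG u).ge)
  have : v ∈ univ.filter (G.Adj u) := he ▸ mem_erase.2 ⟨huv.symm, hv⟩
  simpa using this

theorem IsUnionFour.nonempty_iso [DecidableEq V] (hG : ∀ v, G.vdeg v = 3) {k : ℕ}
    (h : G.IsUnionFour k univ) :
    Nonempty (G ≃g (⊤ : SimpleGraph (Fin 4)).disjointCopies k) := by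
  obtain ⟨f, hf, hdis, hU⟩ := h
  let e : Fin k × Fin 4 → V := fun p => ((f p.1).equivFinOfCardEq (hf p.1).2).symm p.2
  have hmem : ∀ p, e p ∈ f p.1 := fun p => Subtype.property _
  have hfst : ∀ p q : Fin k × Fin 4, e p ∈ f q.1 → p.1 = q.1 := by
    intro p q hpq
    by_contra hne
    exact Finset.disjoint_left.1 (hdis _ _ hne) (hmem p) hpq
  have hinj : Function.Injective e := by
    rintro ⟨i, a⟩ ⟨j, b⟩ hab
    obtain rfl : i = j := hfst (i, a) (j, b) (hab ▸ hmem (j, b))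
    have := ((f i).equivFinOfCardEq (hf i).2).symm.injective (Subtype.ext hab)
    exact Prod.ext rfl this
  have hsurj : Function.Surjective e := by
    intro v
    have hv : v ∈ univ.biUnion f := hU ▸ mem_univ v
    obtain ⟨i, -, hi⟩ := mem_biUnion.1 hv
    exact ⟨(i, (f i).equivFinOfCardEq (hf i).2 ⟨v, hi⟩), by simp [e]⟩
  refine ⟨(RelIso.symm ⟨Equiv.ofBijective e ⟨hinj, hsurj⟩, ?_⟩)⟩
  rintro ⟨i, a⟩ ⟨j, b⟩
  change G.Adj (e (i, a)) (e (j, b)) ↔ i = j ∧ a ≠ b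
  constructor
  · intro hadj
    have hij : i = j :=
      hfst (i, a) (j, b) ((hf j).1 _ (hmem (j, b)) _ hadj.symm)
    refine ⟨hij, ?_⟩
    rintro rfl
    subst hij
    exact hadj.ne rfl
  · rintro ⟨rfl, hab⟩
    exact adj_of_card_four (hf i).1 hG (hf i).2 (hmem (i, a)) (hmem (i, b))
      fun h => hab (by simpa using hinj h)

theorem nonempty_iso_top (hG : ∀ v, G.vdeg v = 3) (h4 : Fintype.card V = 4) :
    Nonempty (G ≃g (⊤ : SimpleGraph (Fin 4))) := by
  refine ⟨⟨Fintype.equivFinOfCardEq h4, ?_⟩⟩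
  intro a b
  rw [top_adj, (Fintype.equivFinOfCardEq h4).injective.ne_iff]
  exact ⟨adj_of_card_four (C := univ) (fun _ _ _ _ => mem_univ _) hG h4 (mem_univ a) (mem_univ b),
    fun h => h.ne⟩

/-- The neighbourhood of `v` is independent, so each of its vertices is joined to all three
non-neighbours of `v` (`v` included). An edge between two of those would then close a triangle. -/
theorem IsTriangleFreeSix.nonempty_iso [Nonempty V] (hG : ∀ v, G.vdeg v = 3)
    (h : G.IsTriangleFreeSix univ) :
    Nonempty (G ≃g completeBipartiteGraph (Fin 3) (Fin 3)) := by
  classical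
  obtain ⟨h6, htri⟩ := h
  obtain ⟨v⟩ := ‹Nonempty V›
  have hcardV : Fintype.card V = 6 := h6
  have hS : Fintype.card {x // G.Adj v x} = 3 := by
    rw [Fintype.card_subtype, ← hG v, vdeg]
  have hT : Fintype.card {x // ¬ G.Adj v x} = 3 := by
    rw [Fintype.card_subtype_compl, hS, hcardV]
  have hST : ∀ x, G.Adj v x → ∀ y, ¬ G.Adj v y → G.Adj x y := by
    intro x hx y hy
    have hs : univ.filter (G.Adj x) ⊆ univ.filter fun z => ¬ G.Adj v z := by
      intro z
      simp only [mem_filter, mem_univ, true_and]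
      exact fun hz => htri v (mem_univ v) x z hx hz
    have he := eq_of_subset_of_card_le hs (by
      rw [← Fintype.card_subtype, hT]
      exact (hG x).ge)
    have : y ∈ univ.filter (G.Adj x) := he ▸ by simpa using hy
    simpa using this
  have hTT : ∀ x, ¬ G.Adj v x → ∀ y, ¬ G.Adj v y → ¬ G.Adj x y := by
    intro x hx y hy hxy
    obtain ⟨s, hs⟩ := exists_adj_of_vdeg_pos (H := G) (u := v) (by rw [hG]; omega)
    exact htri s (mem_univ s) x y (hST s hs x hx) hxy (hST s hs y hy)
  have hSS : ∀ x, G.Adj v x → ∀ y, G.Adj v y → ¬ G.Adj x y :=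
    fun x hx y hy hxy => htri v (mem_univ v) x y hx hxy hy
  let e : {x // G.Adj v x} ⊕ {x // ¬ G.Adj v x} ≃ Fin 3 ⊕ Fin 3 :=
    Equiv.sumCongr (Fintype.equivFinOfCardEq hS) (Fintype.equivFinOfCardEq hT)
  let e' : Fin 3 ⊕ Fin 3 ≃ V := e.symm.trans (Equiv.sumCompl (G.Adj v))
  have hl : ∀ i, G.Adj v (e' (Sum.inl i)) := fun i => by
    simpa [e', e] using ((Fintype.equivFinOfCardEq hS).symm i).2
  have hr : ∀ i, ¬ G.Adj v (e' (Sum.inr i)) := fun i => by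
    simpa [e', e] using ((Fintype.equivFinOfCardEq hT).symm i).2
  refine ⟨RelIso.symm ⟨e', ?_⟩⟩
  rintro (i | i) (j | j)
  · simpa using hSS _ (hl i) _ (hl j)
  · simpa using hST _ (hl i) _ (hr j)
  · simpa using (hST _ (hl j) _ (hr i)).symm
  · simpa using hTT _ (hr i) _ (hr j)

theorem degree_eq_vdeg (H : SimpleGraph V) (v : V) [Fintype (H.neighborSet v)] :
    H.degree v = H.vdeg v := by
  rw [vdeg, ← card_neighborFinset_eq_degree]
  congr 1
  ext w
  simp

theorem degreeMultiplicity_add_cnt (H : SimpleGraph V) (k : ℕ) :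
    H.degreeMultiplicity k + H.cnt univ (k + 1) = H.cnt univ k := by
  rw [← card_vdeg_eq H univ k]
  simp only [degreeMultiplicity, degree_eq_vdeg]

theorem Attains.isDecomposable (hG : ∀ v, G.vdeg v = 3) {a b c : ℕ} (h : G.Attains univ a b c) :
    G.IsDecomposable ![(c : ℤ), b - c, a - b, Fintype.card V - a] := by
  obtain ⟨H, hH, h1, h2, h3⟩ := h
  refine ⟨H, hH, ?_⟩
  have d0 := degreeMultiplicity_add_cnt H 0
  have d1 := degreeMultiplicity_add_cnt H 1
  have d2 := degreeMultiplicity_add_cnt H 2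
  have d3 := degreeMultiplicity_add_cnt H 3
  have h4 : H.cnt univ 4 = 0 := by
    have := cnt_sdiff hG hH univ (j := 0) (k := 4) rfl
    rw [cnt_zero] at this
    omega
  rw [cnt_zero, card_univ] at d0
  norm_num at d0 d1 d2 d3
  intro i
  fin_cases i
  · change (H.degreeMultiplicity 0 : ℤ) = Fintype.card V - a
    omega
  · change (H.degreeMultiplicity 1 : ℤ) = a - b
    omega
  · change (H.degreeMultiplicity 2 : ℤ) = b - c
    omega
  · change (H.degreeMultiplicity 3 : ℤ) = c
    omega

theorem IsDecomposable.of_eq (hG : ∀ v, G.vdeg v = 3) {a b c : ℕ} (h : G.Attains univ a b c)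
    {x y z w : ℤ} (hx : (c : ℤ) = x) (hy : (b : ℤ) - c = y) (hz : (a : ℤ) - b = z)
    (hw : (Fintype.card V : ℤ) - a = w) : G.IsDecomposable ![x, y, z, w] := by
  subst hx hy hz hw
  exact h.isDecomposable hG

end SimpleGraph

theorem mainTheorem2 {V : Type*} [Fintype V] [Nonempty V] (G : SimpleGraph V)
    [DecidableRel G.Adj] (hG : G.IsRegularOfDegree 3) (t : ℕ) :
    (Fintype.card V = 4 * t →
      ¬ Nonempty (G ≃g (⊤ : SimpleGraph (Fin 4))) →
      ¬ Nonempty (G ≃g (⊤ : SimpleGraph (Fin 4)).disjointCopies 3) →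
      G.IsDecomposable ![(t : ℤ), t, t, t]) ∧
    (Fintype.card V = 4 * t →
      ¬ Nonempty (G ≃g (⊤ : SimpleGraph (Fin 4)).disjointCopies 2) →
      G.IsDecomposable ![(t : ℤ) - 1, t - 1, t + 1, t + 1]) ∧
    (Fintype.card V = 4 * t + 2 →
      ¬ Nonempty (G ≃g completeBipartiteGraph (Fin 3) (Fin 3)) →
      G.IsDecomposable ![(t : ℤ), t + 1, t, t + 1]) ∧
    (Fintype.card V = 4 * t + 2 →
      G.IsDecomposable ![(t : ℤ) - 1, t, t + 1, t + 2]) := by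
  classical
  have hG' : ∀ v, G.vdeg v = 3 := by
    intro v
    rw [← hG v, SimpleGraph.degree_eq_vdeg]
  have hcl : G.AdjClosed Finset.univ := fun _ _ _ _ => Finset.mem_univ _
  have hcard : (Finset.univ : Finset V).card = Fintype.card V := Finset.card_univ
  rcases hcl.good_or hG' Finset.univ_nonempty with h | h | h | h | h
  · rcases h with ⟨s, hs, h1, h2⟩ | ⟨s, hs, h1, h2⟩
    · refine ⟨fun hn _ _ => ?_, fun hn _ => ?_, fun hn => by omega, fun hn => by omega⟩
      · exact .of_eq hG' h1 (by omega) (by omega) (by omega) (by omega)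
      · exact .of_eq hG' h2 (by omega) (by omega) (by omega) (by omega)
    · refine ⟨fun hn => by omega, fun hn => by omega, fun hn _ => ?_, fun hn => ?_⟩
      · exact .of_eq hG' h1 (by omega) (by omega) (by omega) (by omega)
      · exact .of_eq hG' h2 (by omega) (by omega) (by omega) (by omega)
  -- In each exceptional case one clause of the right residue is excluded by hypothesis. The other
  -- is met by `(2, 0, 0)` on `K₄`, `(6, 4, 2)` on `2K₄`, `(8, 4, 2)` on `3K₄` and `(3, 1, 0)` on
  -- `K₃,₃`.
  · have hc := h.card
    refine ⟨fun _ hne => absurd (SimpleGraph.nonempty_iso_top hG' (by omega)) hne,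
      fun hn _ => ?_, fun hn => by omega, fun hn => by omega⟩
    exact .of_eq hG' (SimpleGraph.attains_of_card_four hcl hG' hc).1 (by omega) (by omega)
      (by omega) (by omega)
  · have hc := h.card
    refine ⟨fun hn _ _ => ?_, fun _ hne => absurd (h.nonempty_iso hG') hne,
      fun hn => by omega, fun hn => by omega⟩
    exact .of_eq hG' (h.attains_two hG') (by omega) (by omega) (by omega) (by omega)
  · have hc := h.card
    refine ⟨fun _ _ hne => absurd (h.nonempty_iso hG') hne, fun hn _ => ?_,
      fun hn => by omega, fun hn => by omega⟩
    exact .of_eq hG' (h.attains_three hG') (by omega) (by omega) (by omega) (by omega)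
  · have hc := h.1
    refine ⟨fun hn => by omega, fun hn => by omega,
      fun _ hne => absurd (h.nonempty_iso hG') hne, fun hn => ?_⟩
    exact .of_eq hG' (SimpleGraph.attains_of_card_six hcl hG' hc).2.1 (by omega) (by omega)
      (by omega) (by omega)
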